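/- **Setting.** A state $\sigma$ assigns to each program variable a value of that variable's type. An Aczel trace is an initial state followed by a finite or infinite sequence of transitions, each labelled as a program ($\pi$) or environment ($\epsilon$) transition; a finite trace is terminated, aborted or incomplete. A command is a set of traces that contains, for every state, the incomplete trace without transitions, is closed under passing to finite prefixes as incomplete traces, and contains all extensions of its aborted traces. Write $c \succeq d$ ($c$ is refined by $d$) if every trace of $d$ is a trace of $c$; this is a complete lattice with join $\vee$ (non-deterministic choice) and greatest element $\lightning$ (abort). Let $c\mathbin;d$ be sequential composition, $c\parallel d$ parallel composition (a $\pi$ transition of one operand is an $\epsilon$ transition of the other), and $c\Cap d$ weak conjunction (common behaviours, but aborting as soon as one operand aborts). Let $\tau\,p$ be the instantaneous test of $p$, let $\pi\,r$, $\epsilon\,r$ be single program/environment transitions in $r$, and let $\boldsymbol\tau=\tau\,\Sigma$, where $\Sigma$ is the set of all states, $\{p\}=\boldsymbol\tau\vee\tau\,\overline p\mathbin;\lightning$, $\boldsymbol\alpha=\pi\,\mathsf{univ}\vee\epsilon\,\mathsf{univ}$. Let $c^\star$ and $c^\omega$ be the least and greatest fixed points of $y\mapsto\boldsymbol\tau\vee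 c\mathbin;y$. Sequential composition binds most tightly. Put $$\mathsf{rely}\,r=(\boldsymbol\alpha\vee\epsilon\,\overline r\mathbin;\lightning)^\omega,\quad \mathsf{idle}=(\pi\,\mathrm{id}\vee\epsilon\,\mathsf{univ})^\omega\Cap \boldsymbol\alpha^\star\mathbin;(\epsilon\,\mathsf{univ})^\omega,\quad \mathsf{inv}\,I=\{I\}\mathbin;(\pi\,\mathrm{post}(I)\vee\epsilon\,\mathrm{post}(I))^\omega,$$ where $\mathrm{pre}(I)=\{(\sigma_0,\sigma)\mid\sigma_0\in I\}$ and $\mathrm{post}(I)=\{(\sigma_0,\sigma)\mid\sigma\in I\}$. Command $c$ is *data-reified by* $d$ under $I$, written $c\succeq_I d$, if $\mathsf{inv}\,I\Cap c\;\succeq\;\mathsf{inv}\,I\Cap d$. Expressions are built from constants, variables, unary and binary operators; $e_\sigma$ is the value of $e$ in the state $\sigma$. The command $[\![e]\!]_k$ evaluates $e$ to the value $k$ under interference: $[\![e]\!]_k=\mathsf{idle}\mathbin;\tau\{\sigma\mid e_\sigma=k\}\mathbin;\mathsf{idle}$ for a constant or variable $e$, $[\![\ominus e]\!]_k=\bigvee_a[\![e]\!]_a\mathbin;\tau\{\sigma\mid\ominus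 a=k\}$, and $[\![e\oplus e']\!]_k=\bigvee_{a,b}([\![e]\!]_a\parallel[\![e']\!]_b)\mathbin;\tau\{\sigma\mid a\oplus b=k\}$. An expression is invariant under $r$ if its values at $\sigma$ and $\sigma'$ agree whenever $(\sigma,\sigma')\in r$. Constants and variables are single-reference under $r$; $\ominus e$ is if $e$ is; $e\oplus e'$ is if $e$ and $e'$ both are and at least one of them is invariant under $r$. Finally $$\mathsf{if}\ b\ \mathsf{then}\ c\ \mathsf{else}\ d=([\![b]\!]_{\mathsf{true}}\mathbin;c\vee[\![b]\!]_{\mathsf{false}}\mathbin;d)\mathbin;\mathsf{idle},\qquad \mathsf{while}\ b\ \mathsf{do}\ c=([\![b]\!]_{\mathsf{true}}\mathbin;c)^\omega\mathbin;[\![b]\!]_{\mathsf{false}}.$$ **Statement.** Let $I$ be a set of states and $r_1,r_2$ relations on states with $\mathrm{pre}(I)\cap r_1\cap\mathrm{post}(I)\subseteq r_2$. 1. (Expressions) If $e_1$ is single-reference under $r_1$, $e_2$ is single-reference under $r_2$, and $\{\sigma\mid (e_1)_\sigma=k_1\}\supseteq I\cap\{\sigma\mid (e_2)_\sigma=k_2\}$,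 then $$\mathsf{rely}\,r_1\Cap[\![e_1]\!]_{k_1}\;\succeq_I\;\mathsf{rely}\,r_2\Cap[\![e_2]\!]_{k_2}.$$ For 2 and 3 let $b_1,b_2$ be boolean expressions that are single-reference under $r_1$ and $r_2$, respectively, let $B_i=\{\sigma\mid(b_i)_\sigma=\mathsf{true}\}$, and suppose $I\cap B_1=I\cap B_2$. 2. (Conditionals) If $c_1\succeq_I d_1$ and $c_2\succeq_I d_2$, then $$\mathsf{rely}\,r_1\Cap\mathsf{if}\ b_1\ \mathsf{then}\ c_1\ \mathsf{else}\ c_2\;\succeq_I\;\mathsf{rely}\,r_2\Cap\mathsf{if}\ b_2\ \mathsf{then}\ d_1\ \mathsf{else}\ d_2.$$ 3. (Loops) If $c_1\succeq_I c_2$, then $$\mathsf{rely}\,r_1\Cap\mathsf{while}\ b_1\ \mathsf{do}\ c_1\;\succeq_I\;\mathsf{rely}\,r_2\Cap\mathsf{while}\ b_2\ \mathsf{do}\ c_2.$$ -/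

import Mathlib

namespace RelyGuarantee

universe u

/-! ### Aczel traces -/

/-- A transition is made either by the program (`π`) or by its environment (`ε`). -/
inductive Kind : Type
  | pgm
  | env

/-- A finite trace has terminated, has aborted, or is an incomplete (partial or infeasible)
behaviour. -/
inductive Status : Type
  | terminated
  | aborted
  | incomplete

/-- A labelled transition into a state (its source is the preceding state of the trace). -/
abbrev Step (S : Type u) : Type u := Kind × S

/-- Aczel traces: an initial state followed by finitely many transitions and a status,
or an initial state followed by infinitely many transitions. -/
inductive Trace (S : Type u) : Type u
  | fin (s : S) (l : List (Step S)) (st : Status)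
  | inf (s : S) (f : Stream' (Step S))

variable {S : Type u}

/-- The state reached from `s` after the transitions `l`. -/
def finalState : S → List (Step S) → S
  | s, [] => s
  | _, a :: l => finalState a.2 l

namespace Trace

/-- The initial state of a trace. -/
def start : Trace S → S
  | fin s _ _ => s
  | inf s _ => s

/-- The trace that starts in `s`, makes the transitions `l`, and continues as `t`. -/
def prepend (s : S) (l : List (Step S)) : Trace S → Trace S
  | fin _ m st => fin s (l ++ m) st
  | inf _ f => inf s (l ++ₛ f)

/-- The trace `t` starts in `s` and its first transitions are `l`. -/
def HasPrefix : Trace S → S → List (Step S) → Prop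
  | fin s' l' _, s, l => s' = s ∧ l <+: l'
  | inf s' f, s, l => s' = s ∧ ∃ g, f = l ++ₛ g

/-- The trace does not end in termination. -/
def NonTerminated : Trace S → Prop
  | fin _ _ st => st ≠ Status.terminated
  | inf _ _ => True

theorem hasPrefix_fin_self (s : S) (l : List (Step S)) (st : Status) :
    (fin s l st).HasPrefix s l := ⟨rfl, List.prefix_refl l⟩

theorem HasPrefix.mono {t : Trace S} {s : S} {l m : List (Step S)}
    (h : t.HasPrefix s l) (hm : m <+: l) : t.HasPrefix s m := by
  cases t with
  | fin s' l' st => exact ⟨h.1, hm.trans h.2⟩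
  | inf s' f =>
    obtain ⟨rfl, g, rfl⟩ := h
    obtain ⟨k, rfl⟩ := hm
    exact ⟨rfl, k ++ₛ g, by simp⟩

/-- Extension of traces is transitive. -/
theorem HasPrefix.trans {t : Trace S} {s s' : S} {l m : List (Step S)} {st : Status}
    (h : t.HasPrefix s l) (hm : (fin s l st).HasPrefix s' m) : t.HasPrefix s' m := by
  obtain ⟨rfl, hm⟩ := hm
  exact h.mono hm

theorem hasPrefix_start {t : Trace S} {s : S} {l : List (Step S)} (h : t.HasPrefix s l) :
    t.start = s := by
  cases t with
  | fin s' l' st => exact h.1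
  | inf s' f => exact h.1

/-- Two prefixes of the same trace are comparable. -/
theorem HasPrefix.total {t : Trace S} {s s' : S} {l m : List (Step S)}
    (h : t.HasPrefix s l) (hm : t.HasPrefix s' m) : s = s' ∧ (l <+: m ∨ m <+: l) := by
  refine ⟨(hasPrefix_start h).symm.trans (hasPrefix_start hm), ?_⟩
  cases t with
  | fin s' l' st => exact List.prefix_or_prefix_of_prefix h.2 hm.2
  | inf s' f =>
    obtain ⟨rfl, g, rfl⟩ := h
    obtain ⟨-, k, hk⟩ := hm
    have key : ∀ (l m : List (Step S)) (g k : Stream' (Step S)),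
        l ++ₛ g = m ++ₛ k → l <+: m ∨ m <+: l := by
      intro l
      induction l with
      | nil => intro m g k _; exact Or.inl m.nil_prefix
      | cons a l ih =>
        intro m g k hk
        cases m with
        | nil => exact Or.inr (List.nil_prefix)
        | cons b m =>
          rw [Stream'.cons_append_stream, Stream'.cons_append_stream] at hk
          obtain ⟨rfl, h2⟩ := Stream'.cons_injective2 hk
          rcases ih m g k h2 with h | h
          · exact Or.inl ((List.prefix_cons_inj a).2 h)
          · exact Or.inr ((List.prefix_cons_inj a).2 h)
    exact key l m g k hk

/-- A prefix of `prepend s l t` lies within `l`, or is `l` followed by a prefix of `t`. -/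
theorem hasPrefix_prepend {t : Trace S} {s s' : S} {l m : List (Step S)}
    (h : (prepend s l t).HasPrefix s' m) :
    s = s' ∧ (m <+: l ∨ ∃ k, m = l ++ k ∧ t.HasPrefix t.start k) := by
  have hs : (prepend s l t).HasPrefix s l := by
    cases t with
    | fin s1 l1 st => exact ⟨rfl, l.prefix_append l1⟩
    | inf s1 f => exact ⟨rfl, f, rfl⟩
  obtain ⟨rfl, h1 | ⟨k, rfl⟩⟩ := h.total hs
  · exact ⟨rfl, Or.inl h1⟩
  refine ⟨rfl, Or.inr ⟨k, rfl, ?_⟩⟩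
  cases t with
  | fin s1 l1 st => exact ⟨rfl, (List.prefix_append_right_inj l).1 h.2⟩
  | inf s1 f =>
    obtain ⟨-, g, hg⟩ := h
    rw [Stream'.append_append_stream] at hg
    exact ⟨rfl, g, Stream'.append_right_injective _ _ _ hg⟩

theorem prepend_hasPrefix {t u : Trace S} {s r : S} {l k : List (Step S)}
    (h : u.HasPrefix s (l ++ k)) (ht : t = u) (hr : r = finalState s l) :
    ∃ v : Trace S, v.HasPrefix r k ∧ v.start = finalState s l ∧ t = prepend s l v := by
  subst ht hr
  cases t with
  | fin s1 l1 st =>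
    obtain ⟨rfl, m, rfl⟩ := h
    exact ⟨fin _ (k ++ m) st, ⟨rfl, List.prefix_append k m⟩, rfl, by simp [prepend]⟩
  | inf s1 f =>
    obtain ⟨rfl, g, rfl⟩ := h
    exact ⟨inf _ (k ++ₛ g), ⟨rfl, g, rfl⟩, rfl, by simp [prepend]⟩

end Trace

/-! ### Commands -/

/-- A command is a set of Aczel traces that contains every initial state as a trivial partial
behaviour, is closed under taking (finite) prefixes as incomplete behaviours, and, because an
aborted command may do anything, contains every extension of each of its aborted traces. -/
@[ext]
structure Cmd (S : Type u) : Type u where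
  traces : Set (Trace S)
  empty_mem : ∀ s : S, Trace.fin s [] Status.incomplete ∈ traces
  prefix_closed : ∀ t ∈ traces, ∀ (s : S) (l : List (Step S)),
    t.HasPrefix s l → Trace.fin s l Status.incomplete ∈ traces
  abort_closed : ∀ (s : S) (l : List (Step S)), Trace.fin s l Status.aborted ∈ traces →
    ∀ t : Trace S, t.HasPrefix s l → t ∈ traces

namespace Cmd

/-- `d ≤ c` means that `c` is refined by `d`: every behaviour of `d` is a behaviour of `c`. -/
instance : PartialOrder (Cmd S) where
  le d c := d.traces ⊆ c.traces
  le_refl _ := subset_rfl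
  le_trans _ _ _ := Set.Subset.trans
  le_antisymm _ _ h₁ h₂ := Cmd.ext (Set.Subset.antisymm h₁ h₂)

/-- The infeasible command, the least command. -/
def magic : Cmd S where
  traces := {t | ∃ s, t = Trace.fin s [] Status.incomplete}
  empty_mem s := ⟨s, rfl⟩
  prefix_closed := by
    rintro _ ⟨s, rfl⟩ s' l ⟨rfl, h⟩
    obtain rfl := List.prefix_nil.1 h
    exact ⟨_, rfl⟩
  abort_closed := by
    rintro s l ⟨s', h⟩
    cases h

/-- The aborting command `↯`, the greatest command. -/
def abort : Cmd S where
  traces := Set.univ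
  empty_mem _ := trivial
  prefix_closed _ _ _ _ _ := trivial
  abort_closed _ _ _ _ _ := trivial

/-- Non-deterministic choice over a set of commands. -/
def choice (C : Set (Cmd S)) : Cmd S where
  traces := magic.traces ∪ {t | ∃ c ∈ C, t ∈ c.traces}
  empty_mem s := Or.inl ⟨s, rfl⟩
  prefix_closed := by
    rintro t (ht | ⟨c, hc, ht⟩) s l h
    · exact Or.inl (magic.prefix_closed t ht s l h)
    · exact Or.inr ⟨c, hc, c.prefix_closed t ht s l h⟩
  abort_closed := by
    rintro s l (⟨_, h⟩ | ⟨c, hc, h⟩) t ht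
    · cases h
    · exact Or.inr ⟨c, hc, c.abort_closed s l h t ht⟩

/-- Strong conjunction over a set of commands. -/
def strongConj (C : Set (Cmd S)) : Cmd S where
  traces := {t | ∀ c ∈ C, t ∈ c.traces}
  empty_mem s c _ := c.empty_mem s
  prefix_closed t ht s l h c hc := c.prefix_closed t (ht c hc) s l h
  abort_closed s l h t ht c hc := c.abort_closed s l (h c hc) t ht

/-- Binary non-deterministic choice `c ∨ d`. -/
def or (c d : Cmd S) : Cmd S where
  traces := c.traces ∪ d.traces
  empty_mem s := Or.inl (c.empty_mem s)
  prefix_closed := by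
    rintro t (ht | ht) s l h
    · exact Or.inl (c.prefix_closed t ht s l h)
    · exact Or.inr (d.prefix_closed t ht s l h)
  abort_closed := by
    rintro s l (h | h) t ht
    · exact Or.inl (c.abort_closed s l h t ht)
    · exact Or.inr (d.abort_closed s l h t ht)

/-- Binary strong conjunction `c ∧ d`. -/
def and (c d : Cmd S) : Cmd S where
  traces := c.traces ∩ d.traces
  empty_mem s := ⟨c.empty_mem s, d.empty_mem s⟩
  prefix_closed t ht s l h :=
    ⟨c.prefix_closed t ht.1 s l h, d.prefix_closed t ht.2 s l h⟩
  abort_closed s l h t ht :=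
    ⟨c.abort_closed s l h.1 t ht, d.abort_closed s l h.2 t ht⟩

/-- Commands form a complete lattice: choice is the join and strong conjunction the meet. -/
instance : CompleteLattice (Cmd S) where
  top := abort
  bot := magic
  sup := or
  inf := and
  sSup := choice
  sInf := strongConj
  le_top _ _ _ := trivial
  bot_le := by rintro c _ ⟨s, rfl⟩; exact c.empty_mem s
  le_sup_left _ _ := Set.subset_union_left
  le_sup_right _ _ := Set.subset_union_right
  sup_le _ _ _ h₁ h₂ := Set.union_subset h₁ h₂
  inf_le_left _ _ := Set.inter_subset_left
  inf_le_right _ _ := Set.inter_subset_right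
  le_inf _ _ _ h₁ h₂ := Set.subset_inter h₁ h₂
  isLUB_sSup C := by
    refine ⟨fun c hc t ht => Or.inr ⟨c, hc, ht⟩, ?_⟩
    rintro b hb t (⟨s, rfl⟩ | ⟨c, hc, ht⟩)
    · exact b.empty_mem s
    · exact hb hc ht
  isGLB_sInf C := ⟨fun c hc t ht => ht c hc, fun b hb t ht c hc => hb hc ht⟩

/-- The instantaneous test `τ p`. -/
def test (p : Set S) : Cmd S where
  traces := {t | ∃ s, t = Trace.fin s [] Status.incomplete ∨
    (s ∈ p ∧ t = Trace.fin s [] Status.terminated)}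
  empty_mem s := ⟨s, Or.inl rfl⟩
  prefix_closed := by
    rintro _ ⟨s, rfl | ⟨_, rfl⟩⟩ s' l ⟨rfl, h⟩ <;>
    · obtain rfl := List.prefix_nil.1 h
      exact ⟨_, Or.inl rfl⟩
  abort_closed := by
    rintro s l ⟨s', h | ⟨_, h⟩⟩ <;> cases h

/-- The command that makes a single transition of kind `k` satisfying `r`. -/
def atomic (k : Kind) (r : Set (S × S)) : Cmd S where
  traces := {t | ∃ s, t = Trace.fin s [] Status.incomplete ∨
    ∃ s', (s, s') ∈ r ∧ (t = Trace.fin s [(k, s')] Status.incomplete ∨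
      t = Trace.fin s [(k, s')] Status.terminated)}
  empty_mem s := ⟨s, Or.inl rfl⟩
  prefix_closed := by
    rintro _ ⟨s, rfl | ⟨s', hs, rfl | rfl⟩⟩ s₁ l ⟨rfl, h⟩
    · obtain rfl := List.prefix_nil.1 h
      exact ⟨_, Or.inl rfl⟩
    all_goals
      rcases l with _ | ⟨a, l⟩
      · exact ⟨_, Or.inl rfl⟩
      · rw [List.cons_prefix_cons] at h
        obtain ⟨rfl, h⟩ := h
        obtain rfl := List.prefix_nil.1 h
        exact ⟨s, Or.inr ⟨s', hs, Or.inl rfl⟩⟩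
  abort_closed := by
    rintro s l ⟨s', h | ⟨_, _, h | h⟩⟩ <;> cases h

/-- The atomic program command `π r`. -/
def pstep (r : Set (S × S)) : Cmd S := atomic Kind.pgm r

/-- The atomic environment command `ε r`. -/
def estep (r : Set (S × S)) : Cmd S := atomic Kind.env r

/-- Sequential composition `c ; d`. -/
def seq (c d : Cmd S) : Cmd S where
  traces := {t | t ∈ c.traces ∧ t.NonTerminated} ∪
    {t | ∃ s l, Trace.fin s l Status.aborted ∈ c.traces ∧ t.HasPrefix s l} ∪
    {t | ∃ s l u, Trace.fin s l Status.terminated ∈ c.traces ∧ u ∈ d.traces ∧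
      u.start = finalState s l ∧ t = Trace.prepend s l u}
  empty_mem s := Or.inl (Or.inl ⟨c.empty_mem s, fun h => by cases h⟩)
  prefix_closed := by
    rintro t ((⟨ht, _⟩ | ⟨s', l', ha, ht⟩) | ⟨s', l', v, hc, hd, hv, rfl⟩) s l h
    · exact Or.inl (Or.inl ⟨c.prefix_closed t ht s l h, fun h => by cases h⟩)
    · exact Or.inl (Or.inl ⟨c.prefix_closed t (c.abort_closed _ _ ha t ht) s l h,
        fun h => by cases h⟩)
    · obtain ⟨rfl, hl | ⟨k, rfl, hk⟩⟩ := Trace.hasPrefix_prepend h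
      · exact Or.inl (Or.inl ⟨c.prefix_closed _ hc _ l ⟨rfl, hl⟩, fun h => by cases h⟩)
      · exact Or.inr ⟨s', l', Trace.fin v.start k Status.incomplete, hc,
          d.prefix_closed v hd _ k hk, hv, rfl⟩
  abort_closed := by
    rintro s l ((⟨ha, _⟩ | ⟨s', l', ha, h⟩) | ⟨s', l', v, hc, hd, hv, h⟩) t ht
    · exact Or.inl (Or.inr ⟨s, l, ha, ht⟩)
    · exact Or.inl (Or.inr ⟨s', l', ha, ht.trans h⟩)
    · cases v with
      | inf s₁ f => cases h
      | fin s₁ m st =>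
        obtain ⟨rfl, rfl, rfl⟩ := Trace.fin.inj h
        obtain ⟨w, hw, hw', rfl⟩ := Trace.prepend_hasPrefix ht rfl hv
        exact Or.inr ⟨s, l', w, hc, d.abort_closed _ m hd w hw, hw', rfl⟩

/-- Weak conjunction `c ⋒ d`: a common behaviour of `c` and `d`, where one of them aborting, at
a point that the other can reach, makes the conjunction abort. -/
def conj (c d : Cmd S) : Cmd S where
  traces := (c.traces ∩ d.traces) ∪ {t | ∃ s l, t.HasPrefix s l ∧
    ((Trace.fin s l Status.aborted ∈ c.traces ∧ Trace.fin s l Status.incomplete ∈ d.traces) ∨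
     (Trace.fin s l Status.incomplete ∈ c.traces ∧ Trace.fin s l Status.aborted ∈ d.traces))}
  empty_mem s := Or.inl ⟨c.empty_mem s, d.empty_mem s⟩
  prefix_closed := by
    rintro t (⟨hc, hd⟩ | ⟨s', l', ht, h'⟩) s l h
    · exact Or.inl ⟨c.prefix_closed t hc s l h, d.prefix_closed t hd s l h⟩
    · obtain ⟨rfl, hl | hl⟩ := h.total ht
      · have hp : ∀ st, (Trace.fin s l' st).HasPrefix s l := fun _ => ⟨rfl, hl⟩
        refine Or.inl ?_
        rcases h' with ⟨h₁, h₂⟩ | ⟨h₁, h₂⟩ <;>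
          exact ⟨c.prefix_closed _ h₁ s l (hp _), d.prefix_closed _ h₂ s l (hp _)⟩
      · exact Or.inr ⟨s, l', ⟨rfl, hl⟩, h'⟩
  abort_closed := by
    rintro s l (⟨hc, hd⟩ | ⟨s', l', ht', h'⟩) t ht
    · exact Or.inl ⟨c.abort_closed s l hc t ht, d.abort_closed s l hd t ht⟩
    · exact Or.inr ⟨s', l', ht.trans ht', h'⟩

/-- Synchronisation of transitions `a` and `b` of two parallel components into `c`: a program
transition of one is an environment transition of the other. -/
def ParStep (a b c : Step S) : Prop :=
  a.2 = c.2 ∧ b.2 = c.2 ∧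
    ((a.1 = Kind.pgm ∧ b.1 = Kind.env ∧ c.1 = Kind.pgm) ∨
     (a.1 = Kind.env ∧ b.1 = Kind.pgm ∧ c.1 = Kind.pgm) ∨
     (a.1 = Kind.env ∧ b.1 = Kind.env ∧ c.1 = Kind.env))

/-- Synchronisation of finite sequences of transitions (of equal lengths). -/
def ParSteps : List (Step S) → List (Step S) → List (Step S) → Prop
  | [], [], [] => True
  | a :: l, b :: m, c :: n => ParStep a b c ∧ ParSteps l m n
  | _, _, _ => False

/-- Synchronisation of traces: the components start together and end together. -/
def ParTrace : Trace S → Trace S → Trace S → Prop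
  | .fin s₁ l₁ st₁, .fin s₂ l₂ st₂, .fin s l st =>
      s₁ = s ∧ s₂ = s ∧ st₁ = st ∧ st₂ = st ∧ ParSteps l₁ l₂ l
  | .inf s₁ f₁, .inf s₂ f₂, .inf s f =>
      s₁ = s ∧ s₂ = s ∧ ∀ n, ParStep (f₁.get n) (f₂.get n) (f.get n)
  | _, _, _ => False

theorem ParSteps.split {l₁ l₂ l : List (Step S)} (h : ParSteps l₁ l₂ l) {m : List (Step S)}
    (hm : m <+: l) : ∃ m₁ m₂, m₁ <+: l₁ ∧ m₂ <+: l₂ ∧ ParSteps m₁ m₂ m := by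
  induction m generalizing l₁ l₂ l with
  | nil => exact ⟨[], [], List.nil_prefix, List.nil_prefix, trivial⟩
  | cons a m ih =>
    rcases l with _ | ⟨c, l⟩
    · cases List.prefix_nil.1 hm
    rcases l₁ with _ | ⟨a₁, l₁⟩
    · cases l₂ <;> exact h.elim
    rcases l₂ with _ | ⟨a₂, l₂⟩
    · exact h.elim
    rw [List.cons_prefix_cons] at hm
    obtain ⟨rfl, hm⟩ := hm
    obtain ⟨m₁, m₂, h₁, h₂, h₃⟩ := ih h.2 hm
    exact ⟨a₁ :: m₁, a₂ :: m₂, (List.prefix_cons_inj _).2 h₁, (List.prefix_cons_inj _).2 h₂,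
      h.1, h₃⟩

theorem ParSteps.ofStream (m : List (Step S)) : ∀ (f₁ f₂ g : Stream' (Step S)),
    (∀ n, ParStep (f₁.get n) (f₂.get n) ((m ++ₛ g).get n)) →
    ParSteps (f₁.take m.length) (f₂.take m.length) m := by
  induction m with
  | nil => intro _ _ _ _; exact trivial
  | cons a m ih =>
    intro f₁ f₂ g h
    exact ⟨h 0, ih f₁.tail f₂.tail g fun n => h (n + 1)⟩

theorem ParTrace.split {t₁ t₂ t : Trace S} (h : ParTrace t₁ t₂ t) {s : S} {m : List (Step S)}
    (hm : t.HasPrefix s m) :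
    ∃ m₁ m₂, t₁.HasPrefix s m₁ ∧ t₂.HasPrefix s m₂ ∧ ParSteps m₁ m₂ m := by
  cases t with
  | fin s' l st =>
    cases t₁ with
    | inf _ _ => cases t₂ <;> exact h.elim
    | fin s₁ l₁ st₁ =>
      cases t₂ with
      | inf _ _ => exact h.elim
      | fin s₂ l₂ st₂ =>
        obtain ⟨rfl, rfl, -, -, h⟩ := h
        obtain ⟨rfl, hm⟩ := hm
        obtain ⟨m₁, m₂, h₁, h₂, h₃⟩ := h.split hm
        exact ⟨m₁, m₂, ⟨rfl, h₁⟩, ⟨rfl, h₂⟩, h₃⟩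
  | inf s' f =>
    cases t₁ with
    | fin _ _ _ => cases t₂ <;> exact h.elim
    | inf s₁ f₁ =>
      cases t₂ with
      | fin _ _ _ => exact h.elim
      | inf s₂ f₂ =>
        obtain ⟨rfl, rfl, h⟩ := h
        obtain ⟨rfl, g, rfl⟩ := hm
        exact ⟨f₁.take m.length, f₂.take m.length,
          ⟨rfl, f₁.drop m.length, (Stream'.append_take_drop _ _).symm⟩,
          ⟨rfl, f₂.drop m.length, (Stream'.append_take_drop _ _).symm⟩,
          ParSteps.ofStream m f₁ f₂ g h⟩

/-- Parallel composition `c ∥ d`: synchronised behaviours of `c` and `d`, where one of them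
aborting, at a point that the other can reach, makes the composition abort. -/
def par (c d : Cmd S) : Cmd S where
  traces := {t | ∃ t₁ ∈ c.traces, ∃ t₂ ∈ d.traces, ParTrace t₁ t₂ t} ∪
    {t | ∃ s l l₁ l₂, t.HasPrefix s l ∧ ParSteps l₁ l₂ l ∧
      ((Trace.fin s l₁ Status.aborted ∈ c.traces ∧
          Trace.fin s l₂ Status.incomplete ∈ d.traces) ∨
       (Trace.fin s l₁ Status.incomplete ∈ c.traces ∧
          Trace.fin s l₂ Status.aborted ∈ d.traces))}
  empty_mem s := Or.inl ⟨_, c.empty_mem s, _, d.empty_mem s, rfl, rfl, rfl, rfl, trivial⟩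
  prefix_closed := by
    rintro t (⟨t₁, h₁, t₂, h₂, ht⟩ | ⟨s', l, l₁, l₂, ht, hl, h'⟩) s m h
    · obtain ⟨m₁, m₂, hm₁, hm₂, hm⟩ := ht.split h
      exact Or.inl ⟨_, c.prefix_closed _ h₁ s m₁ hm₁, _, d.prefix_closed _ h₂ s m₂ hm₂,
        rfl, rfl, rfl, rfl, hm⟩
    · obtain ⟨rfl, hm | hm⟩ := h.total ht
      · obtain ⟨m₁, m₂, hm₁, hm₂, hp⟩ := hl.split hm
        refine Or.inl ?_
        rcases h' with ⟨h₁, h₂⟩ | ⟨h₁, h₂⟩ <;>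
          exact ⟨_, c.prefix_closed _ h₁ s m₁ ⟨rfl, hm₁⟩, _, d.prefix_closed _ h₂ s m₂ ⟨rfl, hm₂⟩,
            rfl, rfl, rfl, rfl, hp⟩
      · exact Or.inr ⟨s, l, l₁, l₂, ⟨rfl, hm⟩, hl, h'⟩
  abort_closed := by
    rintro s l (⟨t₁, h₁, t₂, h₂, h⟩ | ⟨s', l', l₁, l₂, ht', hl, h'⟩) t ht
    · cases t₁ with
      | inf _ _ => cases t₂ <;> exact h.elim
      | fin s₁ l₁ st₁ =>
        cases t₂ with
        | inf _ _ => exact h.elim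
        | fin s₂ l₂ st₂ =>
          obtain ⟨rfl, rfl, rfl, rfl, h⟩ := h
          exact Or.inr ⟨_, l, l₁, l₂, ht, h, Or.inl ⟨h₁,
            d.prefix_closed _ h₂ _ _ (Trace.hasPrefix_fin_self _ _ _)⟩⟩
    · exact Or.inr ⟨s', l', l₁, l₂, ht.trans ht', hl, h'⟩

theorem seq_mono_right (c : Cmd S) {d d' : Cmd S} (h : d ≤ d') : c.seq d ≤ c.seq d' := by
  rintro t (ht | ⟨s, l, v, hc, hd, hv, rfl⟩)
  · exact Or.inl ht
  · exact Or.inr ⟨s, l, v, hc, h hd, hv, rfl⟩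

/-! ### Derived commands -/

/-- The command `τ` that terminates immediately from every state. -/
def nil : Cmd S := test Set.univ

/-- The assertion `{p}`. -/
def assert (p : Set S) : Cmd S := nil ⊔ (test pᶜ).seq abort

/-- A single program or environment transition satisfying `r`. -/
def cstep (r : Set (S × S)) : Cmd S := pstep r ⊔ estep r

/-- The function `y ↦ τ ∨ c ; y`. -/
def iterStep (c : Cmd S) : Cmd S →o Cmd S :=
  ⟨fun y => nil ⊔ c.seq y, fun _ _ h => sup_le_sup_left (seq_mono_right c h) nil⟩

/-- Finite iteration, the least fixed point of `y ↦ τ ∨ c ; y`. -/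
def finIter (c : Cmd S) : Cmd S := (iterStep c).lfp

/-- Possibly infinite iteration `c ^ ω`, the greatest fixed point of `y ↦ τ ∨ c ; y`. -/
def iter (c : Cmd S) : Cmd S := (iterStep c).gfp

/-- The program guarantee command. -/
def guar (r : Set (S × S)) : Cmd S := (pstep r ⊔ estep Set.univ).iter

/-- The rely command. -/
def rely (r : Set (S × S)) : Cmd S := (cstep Set.univ ⊔ (estep rᶜ).seq abort).iter

/-- Termination after finitely many program transitions. -/
def term : Cmd S := (cstep Set.univ).finIter.seq (estep Set.univ).iter

/-- Pairs of states whose initial state is in `p`. -/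
def preRel (p : Set S) : Set (S × S) := {x | x.1 ∈ p}

/-- Pairs of states whose final state is in `p`. -/
def postRel (p : Set S) : Set (S × S) := {x | x.2 ∈ p}

/-- The invariant command: every transition establishes `I`, provided `I` holds initially;
otherwise it aborts. -/
def inv (I : Set S) : Cmd S := (assert I).seq (cstep (postRel I)).iter

/-- `d` is a data reification of `c` under the coupling invariant `I`. -/
def DataReifies (I : Set S) (c d : Cmd S) : Prop := (inv I).conj d ≤ (inv I).conj c

end Cmd

/-! ### Program variables and expressions -/

/-- A program state gives each program variable a value (of the type of the variable). -/
abbrev State {Var : Type u} (Val : Var → Type) : Type u := (x : Var) → Val x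

variable {Var : Type u} {Val : Var → Type}

/-- The relation that leaves the variables in `V` unchanged. -/
def idOn (V : Set Var) : Set (State Val × State Val) := {x | ∀ v ∈ V, x.2 v = x.1 v}

namespace Cmd

/-- `V : c` restricts the program transitions of `c` to modify only variables in `V`. -/
def frame (V : Set Var) (c : Cmd (State Val)) : Cmd (State Val) := (guar (idOn Vᶜ)).conj c

/-- Finitely many program transitions, none of which changes the state. -/
def idle : Cmd (State Val) := frame ∅ term

end Cmd

/-- Expressions with values in a type: constants, program variables, and unary and binary
operators applied to expressions. -/
inductive Expr (Val : Var → Type) : Type → Type (max u 1)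
  | const {α : Type} (a : α) : Expr Val α
  | var (x : Var) : Expr Val (Val x)
  | unary {α β : Type} (f : α → β) (e : Expr Val α) : Expr Val β
  | binary {α β γ : Type} (f : α → β → γ) (e₁ : Expr Val α) (e₂ : Expr Val β) : Expr Val γ

namespace Expr

/-- The value of an expression in a single state. -/
def value : {α : Type} → Expr Val α → State Val → α
  | _, const a, _ => a
  | _, var x, σ => σ x
  | _, unary f e, σ => f (e.value σ)
  | _, binary f e₁ e₂, σ => f (e₁.value σ) (e₂.value σ)

/-- The command `⟦e⟧ k` that evaluates `e`, under interference, to the value `k`, and is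
infeasible if `e` evaluates to any other value. A variable is read in a single atomic access,
and the operands of a binary operator are evaluated in parallel. -/
def eval : {α : Type} → Expr Val α → α → Cmd (State Val)
  | _, const a, k => Cmd.idle.seq ((Cmd.test {_σ | a = k}).seq Cmd.idle)
  | _, var x, k => Cmd.idle.seq ((Cmd.test {σ | σ x = k}).seq Cmd.idle)
  | _, unary f e, k => ⨆ a, (e.eval a).seq (Cmd.test {_σ | f a = k})
  | _, binary f e₁ e₂, k =>
      ⨆ a, ⨆ b, ((e₁.eval a).par (e₂.eval b)).seq (Cmd.test {_σ | f a b = k})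

/-- The value of `e` is invariant under `r`. -/
def InvariantUnder {α : Type} (e : Expr Val α) (r : Set (State Val × State Val)) : Prop :=
  ∀ σ σ' : State Val, (σ, σ') ∈ r → e.value σ' = e.value σ

/-- `e` is single-reference under `r`: constants and (atomically accessed) variables are; a
unary expression is if its operand is; and a binary expression is if both its operands are and
at least one of them is invariant under `r`. -/
def SingleReference (r : Set (State Val × State Val)) : {α : Type} → Expr Val α → Prop
  | _, const _ => True
  | _, var _ => True
  | _, unary _ e => e.SingleReference r
  | _, binary _ e₁ e₂ => e₁.SingleReference r ∧ e₂.SingleReference r ∧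
      (e₁.InvariantUnder r ∨ e₂.InvariantUnder r)

end Expr

namespace Cmd

/-- The conditional `if b then c else d`. -/
def ifThenElse (b : Expr Val Bool) (c d : Cmd (State Val)) : Cmd (State Val) :=
  ((b.eval true).seq c ⊔ (b.eval false).seq d).seq idle

/-- The loop `while b do c`. -/
def whileDo (b : Expr Val Bool) (c : Cmd (State Val)) : Cmd (State Val) :=
  ((b.eval true).seq c).iter.seq (b.eval false)

end Cmd

end RelyGuarantee

namespace RelyGuarantee

universe u

variable {S : Type u}

/-! Everything is compared trace by trace. From a state outside `I`, `inv I` aborts; otherwise it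
allows exactly the non-aborted traces that stay in `I`. So reification under `I` is inclusion of the
traces that stay in `I` (`dataReifies_iff`). Conjunction with `rely r` adds to a command precisely
all extensions of those of its finite traces that contain an environment transition outside `r`
(`mem_rely_conj`). Inside `I` a violation of `r₂` is also a violation of `r₁`, so it suffices to
compare commands on regular traces: those that stay in `I` and stop, incomplete, at the first
violation of `r₁` (`RegularRefines.dataReifies`).

Refinement on regular traces mentions no rely and is compositional. For a sequential composition,
cut the trace where the first command terminates. If the first piece has no violation, it is regular
with any status, and so is the rest; otherwise the whole trace is that piece, incomplete, and prefix
closure suffices (`RegularRefines.mem_seq`). Iteration follows by coinduction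
(`RegularRefines.iter`). Conditionals and loops thus reduce to their guards.

A trace of `⟦e⟧ k` is an idle trace such that, if it terminates, `k` results from reading each
variable occurrence in some visited state, possibly different ones (`mem_eval`). When the
environment respects `r`, expressions invariant under `r` are constant along an idle trace, so a
single-reference expression has the value `k` in one visited state (`Evaluates.exists_value`). That
state lies in `I`, so `e₁` has the value `k₁` there, and reading all of `e₁` in it yields `k₁`. -/

theorem finalState_append (s : S) (l m : List (Step S)) :
    finalState s (l ++ m) = finalState (finalState s l) m := by
  induction l generalizing s with
  | nil => rfl
  | cons a l ih => exact ih a.2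

/-! ### Concatenation of traces and properties of their transitions -/

namespace Trace

theorem start_prepend (s : S) (l : List (Step S)) (t : Trace S) : (prepend s l t).start = s := by
  cases t <;> rfl

theorem hasPrefix_nil (t : Trace S) : t.HasPrefix t.start [] := by
  cases t with
  | fin s l st => exact ⟨rfl, List.nil_prefix⟩
  | inf s f => exact ⟨rfl, f, rfl⟩

theorem HasPrefix.prepend {t : Trace S} {k : List (Step S)} (h : t.HasPrefix t.start k)
    (s : S) (l : List (Step S)) : (prepend s l t).HasPrefix s (l ++ k) := by
  cases t with
  | fin s' m st => exact ⟨rfl, (List.prefix_append_right_inj l).2 h.2⟩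
  | inf s' f =>
    obtain ⟨-, g, rfl⟩ := h
    exact ⟨rfl, g, by simp⟩

theorem hasPrefix_prepend_self (s : S) (l : List (Step S)) (t : Trace S) :
    (Trace.prepend s l t).HasPrefix s l := by
  simpa using (hasPrefix_nil t).prepend s l

/-- Concatenation forgets the initial state of the second trace, hence the hypothesis on starts. -/
theorem prepend_inj {s : S} {l : List (Step S)} {t u : Trace S} (hs : t.start = u.start)
    (h : Trace.prepend s l t = Trace.prepend s l u) : t = u := by
  cases t with
  | fin s₁ m₁ st₁ =>
    cases u with
    | fin s₂ m₂ st₂ =>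
      obtain ⟨-, hm, rfl⟩ := Trace.fin.inj h
      obtain rfl := List.append_cancel_left hm
      obtain rfl : s₁ = s₂ := hs
      rfl
    | inf s₂ f₂ => cases h
  | inf s₁ f₁ =>
    cases u with
    | fin s₂ m₂ st₂ => cases h
    | inf s₂ f₂ =>
      obtain ⟨-, h⟩ := Trace.inf.inj h
      obtain rfl := Stream'.append_right_injective _ _ _ h
      obtain rfl : s₁ = s₂ := hs
      rfl

/-- A trace has no transitions, or it consists of a transition followed by a trace. -/
theorem eq_nil_or_cons (t : Trace S) : (∃ s st, t = fin s [] st) ∨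
    ∃ s a u, u.start = a.2 ∧ t = Trace.prepend s [a] u := by
  cases t with
  | fin s l st =>
    cases l with
    | nil => exact Or.inl ⟨s, st, rfl⟩
    | cons a l => exact Or.inr ⟨s, a, fin a.2 l st, rfl, rfl⟩
  | inf s f =>
    exact Or.inr ⟨s, f.head, inf f.head.2 f.tail, rfl, congrArg (inf s) f.eta.symm⟩

theorem HasPrefix.of_cons {s s' : S} {a b : Step S} {u : Trace S} {k : List (Step S)}
    (h : (Trace.prepend s [a] u).HasPrefix s' (b :: k)) :
    s = s' ∧ a = b ∧ u.HasPrefix u.start k := by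
  cases u with
  | fin s₁ l st =>
    obtain ⟨hs, h⟩ := h
    obtain ⟨rfl, hk⟩ := List.cons_prefix_cons.1 h
    exact ⟨hs, rfl, rfl, hk⟩
  | inf s₁ f =>
    obtain ⟨hs, g, h⟩ := h
    obtain ⟨rfl, hg⟩ := Stream'.cons_injective2 h
    exact ⟨hs, rfl, rfl, g, hg⟩

/-- The trace does not end by aborting. -/
def NotAborted : Trace S → Prop
  | fin _ _ st => st ≠ Status.aborted
  | inf _ _ => True

theorem not_notAborted {t : Trace S} : ¬ t.NotAborted ↔ ∃ s l, t = fin s l Status.aborted := by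
  cases t with
  | fin s l st => simp [NotAborted]
  | inf s f => simp [NotAborted]

theorem notAborted_prepend {s : S} {l : List (Step S)} {t : Trace S} :
    (Trace.prepend s l t).NotAborted ↔ t.NotAborted := by
  cases t <;> rfl

/-- Every transition of the trace satisfies `P`, a predicate on its source and the transition. -/
def Steps (P : S → Step S → Prop) (t : Trace S) : Prop :=
  ∀ s l a, t.HasPrefix s (l ++ [a]) → P (finalState s l) a

theorem Steps.mono {P Q : S → Step S → Prop} {t : Trace S} (h : t.Steps P)
    (hPQ : ∀ s a, P s a → Q s a) : t.Steps Q :=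
  fun s l a hp => hPQ _ _ (h s l a hp)

theorem Steps.of_hasPrefix {P : S → Step S → Prop} {t : Trace S} (h : t.Steps P) {s : S}
    {l : List (Step S)} (hl : t.HasPrefix s l) (st : Status) : (fin s l st).Steps P :=
  fun s' m a hm => h s' m a (hl.trans (st := st) hm)

theorem steps_nil (P : S → Step S → Prop) (s : S) (st : Status) : (fin s [] st).Steps P := by
  rintro s' l a ⟨-, h⟩
  simp at h

/-- Being stepwise is a safety property: failure already shows on a finite prefix, which includes
the offending transition. -/
theorem exists_not_steps {P : S → Step S → Prop} {t : Trace S} (h : ¬ t.Steps P) :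
    ∃ s l, t.HasPrefix s l ∧ ¬ (fin s l Status.incomplete).Steps P := by
  simp only [Steps, not_forall] at h
  obtain ⟨s, l, a, hp, hn⟩ := h
  exact ⟨s, l ++ [a], hp, fun hs => hn (hs s l a (hasPrefix_fin_self _ _ _))⟩

theorem steps_prepend {P : S → Step S → Prop} {s : S} {l : List (Step S)} {u : Trace S}
    (hu : u.start = finalState s l) (st : Status) :
    (Trace.prepend s l u).Steps P ↔ (fin s l st).Steps P ∧ u.Steps P := by
  constructor
  · intro h
    refine ⟨h.of_hasPrefix (hasPrefix_prepend_self s l u) st, fun s' k a hk => ?_⟩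
    obtain rfl := hasPrefix_start hk
    have := h s (l ++ k) a (by simpa using hk.prepend s l)
    rwa [finalState_append, ← hu] at this
  · rintro ⟨h₁, h₂⟩ s' m a hm
    obtain ⟨rfl, h | ⟨k, hk, hp⟩⟩ := hasPrefix_prepend hm
    · exact h₁ s m a ⟨rfl, h⟩
    · rcases List.eq_nil_or_concat k with rfl | ⟨k', b, rfl⟩
      · exact h₁ s m a ⟨rfl, by simp [hk]⟩
      · rw [List.concat_eq_append, ← List.append_assoc] at hk
        obtain ⟨rfl, hb⟩ := List.append_inj' hk rfl
        obtain rfl : a = b := by simpa using hb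
        rw [finalState_append, ← hu]
        exact h₂ _ k' a (by simpa using hp)

theorem steps_singleton {P : S → Step S → Prop} {s : S} {a : Step S} {st : Status} :
    (fin s [a] st).Steps P ↔ P s a := by
  constructor
  · intro h
    exact h s [] a (hasPrefix_fin_self _ _ _)
  · rintro h s' l b ⟨rfl, hp⟩
    cases l with
    | nil =>
      obtain rfl : b = a := by simpa using hp
      exact h
    | cons c l => simp at hp

theorem steps_cons {P : S → Step S → Prop} {s : S} {a : Step S} {u : Trace S}
    (hu : u.start = a.2) : (Trace.prepend s [a] u).Steps P ↔ P s a ∧ u.Steps P := by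
  rw [steps_prepend (l := [a]) hu Status.incomplete, steps_singleton]

end Trace

/-! ### Trace descriptions of iteration, rely and invariant -/

namespace Cmd

open Trace

theorem mem_of_hasPrefix {c : Cmd S} {t : Trace S} (ht : t ∈ c.traces) {s : S}
    {l : List (Step S)} (h : t.HasPrefix s l) : fin s l Status.incomplete ∈ c.traces :=
  c.prefix_closed t ht s l h

theorem mem_sup {c d : Cmd S} {t : Trace S} :
    t ∈ (c ⊔ d).traces ↔ t ∈ c.traces ∨ t ∈ d.traces := Iff.rfl

theorem mem_iSup {ι : Sort*} {c : ι → Cmd S} {t : Trace S} :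
    t ∈ (⨆ i, c i).traces ↔ (∃ s, t = fin s [] Status.incomplete) ∨ ∃ i, t ∈ (c i).traces := by
  change _ ∨ (∃ d ∈ Set.range c, t ∈ d.traces) ↔ _
  simp [magic]

theorem mem_seq {c d : Cmd S} {t : Trace S} : t ∈ (c.seq d).traces ↔
    (t ∈ c.traces ∧ t.NonTerminated) ∨
    (∃ s l, fin s l Status.aborted ∈ c.traces ∧ t.HasPrefix s l) ∨
    ∃ s l u, fin s l Status.terminated ∈ c.traces ∧ u ∈ d.traces ∧
      u.start = finalState s l ∧ t = prepend s l u :=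
  or_assoc

theorem mem_nil {t : Trace S} :
    t ∈ (nil : Cmd S).traces ↔ ∃ s st, st ≠ Status.aborted ∧ t = fin s [] st := by
  constructor
  · rintro ⟨s, rfl | ⟨-, rfl⟩⟩
    · exact ⟨s, _, by simp, rfl⟩
    · exact ⟨s, _, by simp, rfl⟩
  · rintro ⟨s, st, hst, rfl⟩
    cases st with
    | terminated => exact ⟨s, Or.inr ⟨trivial, rfl⟩⟩
    | aborted => exact absurd rfl hst
    | incomplete => exact ⟨s, Or.inl rfl⟩

theorem iter_eq (c : Cmd S) : c.iter = nil ⊔ c.seq c.iter := (iterStep c).map_gfp.symm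

theorem le_iter {c d : Cmd S} (h : d ≤ nil ⊔ c.seq d) : d ≤ c.iter := (iterStep c).le_gfp h

theorem finIter_eq (c : Cmd S) : c.finIter = nil ⊔ c.seq c.finIter := (iterStep c).map_lfp.symm

theorem finIter_le {c d : Cmd S} (h : nil ⊔ c.seq d ≤ d) : c.finIter ≤ d := (iterStep c).lfp_le h

theorem seq_mono_left {c c' : Cmd S} (h : c ≤ c') (d : Cmd S) : c.seq d ≤ c'.seq d := by
  intro t ht
  rcases mem_seq.1 ht with ⟨h₁, h₂⟩ | ⟨s, l, h₁, h₂⟩ | ⟨s, l, u, h₁, h₂⟩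
  · exact mem_seq.2 (Or.inl ⟨h h₁, h₂⟩)
  · exact mem_seq.2 (Or.inr (Or.inl ⟨s, l, h h₁, h₂⟩))
  · exact mem_seq.2 (Or.inr (Or.inr ⟨s, l, u, h h₁, h₂⟩))

theorem iter_mono {c d : Cmd S} (h : c ≤ d) : c.iter ≤ d.iter := by
  apply le_iter
  conv_lhs => rw [iter_eq]
  exact sup_le_sup_left (seq_mono_left h _) _

theorem prepend_mem_seq {c d : Cmd S} {s : S} {l : List (Step S)} {u : Trace S}
    (hc : fin s l Status.terminated ∈ c.traces) (hu : u ∈ d.traces)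
    (hs : u.start = finalState s l) : prepend s l u ∈ (c.seq d).traces :=
  Or.inr ⟨s, l, u, hc, hu, hs, rfl⟩

/-- The command makes at most one transition, which satisfies `P`, and then terminates. -/
def IsStep (c : Cmd S) (P : S → Step S → Prop) : Prop :=
  ∀ t, t ∈ c.traces ↔ (∃ s, t = fin s [] Status.incomplete) ∨
    ∃ s a, P s a ∧ (t = fin s [a] Status.incomplete ∨ t = fin s [a] Status.terminated)

theorem isStep_atomic (k : Kind) (r : Set (S × S)) :
    (atomic k r).IsStep fun s a => a.1 = k ∧ (s, a.2) ∈ r := by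
  intro t
  constructor
  · rintro ⟨s, rfl | ⟨s', h, h'⟩⟩
    · exact Or.inl ⟨s, rfl⟩
    · exact Or.inr ⟨s, (k, s'), ⟨rfl, h⟩, h'⟩
  · rintro (⟨s, rfl⟩ | ⟨s, ⟨_, s'⟩, ⟨rfl, h⟩, h'⟩)
    · exact ⟨s, Or.inl rfl⟩
    · exact ⟨s, Or.inr ⟨s', h, h'⟩⟩

theorem IsStep.sup {c d : Cmd S} {P Q : S → Step S → Prop} (hc : c.IsStep P) (hd : d.IsStep Q) :
    (c ⊔ d).IsStep fun s a => P s a ∨ Q s a := by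
  intro t
  rw [mem_sup, hc, hd]
  constructor
  · rintro ((h | ⟨s, a, h, h'⟩) | (h | ⟨s, a, h, h'⟩))
    exacts [Or.inl h, Or.inr ⟨s, a, Or.inl h, h'⟩, Or.inl h, Or.inr ⟨s, a, Or.inr h, h'⟩]
  · rintro (h | ⟨s, a, h | h, h'⟩)
    exacts [Or.inl (Or.inl h), Or.inl (Or.inr ⟨s, a, h, h'⟩), Or.inr (Or.inr ⟨s, a, h, h'⟩)]

theorem IsStep.terminated_mem {c : Cmd S} {P : S → Step S → Prop} (hc : c.IsStep P) {s : S}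
    {a : Step S} (h : P s a) : fin s [a] Status.terminated ∈ c.traces :=
  (hc _).2 (Or.inr ⟨s, a, h, Or.inr rfl⟩)

theorem IsStep.mem_seq {c d : Cmd S} {P : S → Step S → Prop} (hc : c.IsStep P) {t : Trace S}
    (ht : t ∈ (c.seq d).traces) : (∃ s, t = fin s [] Status.incomplete) ∨
      ∃ s a u, P s a ∧ u.start = a.2 ∧ u ∈ d.traces ∧ t = prepend s [a] u := by
  rcases Cmd.mem_seq.1 ht with ⟨h₁, h₂⟩ | ⟨s, l, h₁, h₂⟩ | ⟨s, l, u, h₁, hd, hu, rfl⟩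
  · rcases (hc _).1 h₁ with h | ⟨s, a, h, rfl | rfl⟩
    · exact Or.inl h
    · exact Or.inr ⟨s, a, fin a.2 [] Status.incomplete, h, rfl, d.empty_mem _, rfl⟩
    · exact absurd rfl h₂
  · rcases (hc _).1 h₁ with ⟨s, h⟩ | ⟨s, a, h, h' | h'⟩
    · cases h
    · cases h'
    · cases h'
  · rcases (hc _).1 h₁ with ⟨s, h⟩ | ⟨s, a, h, h' | h'⟩
    · cases h
    · cases h'
    · obtain ⟨rfl, rfl, -⟩ := Trace.fin.inj h'
      exact Or.inr ⟨_, a, u, h, hu, hd, rfl⟩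

/-- Unfolding the fixed point once peels off one transition, so induction on the length of a prefix
gives one direction. The other is coinduction, which also admits infinite traces. -/
theorem IsStep.mem_iter {c : Cmd S} {P : S → Step S → Prop} (hc : c.IsStep P) {t : Trace S} :
    t ∈ c.iter.traces ↔ t.NotAborted ∧ t.Steps P := by
  constructor
  · intro ht
    have key : ∀ {t : Trace S}, t ∈ c.iter.traces →
        (∃ s st, st ≠ Status.aborted ∧ t = fin s [] st) ∨
        ∃ s a u, P s a ∧ u.start = a.2 ∧ u ∈ c.iter.traces ∧ t = prepend s [a] u := by
      intro t ht
      rw [iter_eq] at ht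
      rcases ht with ht | ht
      · exact Or.inl (mem_nil.1 ht)
      · rcases hc.mem_seq ht with ⟨s, rfl⟩ | h
        · exact Or.inl ⟨s, _, by simp, rfl⟩
        · exact Or.inr h
    constructor
    · cases t with
      | inf s f => trivial
      | fin s l st =>
        induction l generalizing s with
        | nil =>
          rcases key ht with ⟨s', st', h, h'⟩ | ⟨s', a, u, _, _, _, h'⟩
          · cases h'; exact h
          · cases u <;> cases h'
        | cons b l ih =>
          rcases key ht with ⟨s', st', h, h'⟩ | ⟨s', a, u, _, _, hu, h'⟩
          · cases h'
          · cases u with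
            | inf _ _ => cases h'
            | fin s₁ m st₁ =>
              cases h'
              exact ih _ hu
    · intro s l
      induction l generalizing t s with
      | nil =>
        intro a h
        rcases key ht with ⟨s', st', -, rfl⟩ | ⟨s', b, u, hP, hu, hm, rfl⟩
        · exact steps_nil P s' st' s [] a h
        · obtain ⟨rfl, rfl, -⟩ := HasPrefix.of_cons h
          exact hP
      | cons b l ih =>
        intro a h
        rcases key ht with ⟨s', st', -, rfl⟩ | ⟨s', b, u, hP, hu, hm, rfl⟩
        · exact steps_nil P s' st' s (_ :: l) a h
        · obtain ⟨rfl, rfl, hk⟩ := HasPrefix.of_cons h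
          have := ih hm _ a hk
          rwa [hu] at this
  · let d : Cmd S :=
      { traces := {t | t.NotAborted ∧ t.Steps P}
        empty_mem := fun s => ⟨by simp [NotAborted], steps_nil P s _⟩
        prefix_closed := fun t ht s l h => ⟨by simp [NotAborted], ht.2.of_hasPrefix h _⟩
        abort_closed := fun s l h => absurd rfl h.1 }
    refine fun ht => le_iter (d := d) ?_ ht
    intro t ht
    rcases eq_nil_or_cons t with ⟨s, st, rfl⟩ | ⟨s, a, u, hu, rfl⟩
    · exact Or.inl (mem_nil.2 ⟨s, st, ht.1, rfl⟩)
    · have h := (steps_cons hu).1 ht.2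
      exact Or.inr (prepend_mem_seq (hc.terminated_mem h.1)
        ⟨notAborted_prepend.1 ht.1, h.2⟩ hu)

theorem isStep_cstep (r : Set (S × S)) : (cstep r).IsStep fun s a => (s, a.2) ∈ r := by
  refine (congrArg (IsStep _) ?_).mp ((isStep_atomic Kind.pgm r).sup (isStep_atomic Kind.env r))
  funext s ⟨k, s'⟩
  cases k <;> simp

/-- A transition of the environment satisfies `r`. -/
def EnvIn (r : Set (S × S)) (s : S) (a : Step S) : Prop := a.1 = Kind.env → (s, a.2) ∈ r

theorem mem_sup_seq {c d e : Cmd S} {t : Trace S} (h : t ∈ ((c ⊔ d).seq e).traces) :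
    t ∈ (c.seq e).traces ∨ t ∈ (d.seq e).traces := by
  rcases mem_seq.1 h with ⟨h₁ | h₁, h₂⟩ | ⟨s, l, h₁ | h₁, h₂⟩ | ⟨s, l, u, h₁ | h₁, h₂⟩
  · exact Or.inl (mem_seq.2 (Or.inl ⟨h₁, h₂⟩))
  · exact Or.inr (mem_seq.2 (Or.inl ⟨h₁, h₂⟩))
  · exact Or.inl (mem_seq.2 (Or.inr (Or.inl ⟨s, l, h₁, h₂⟩)))
  · exact Or.inr (mem_seq.2 (Or.inr (Or.inl ⟨s, l, h₁, h₂⟩)))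
  · exact Or.inl (mem_seq.2 (Or.inr (Or.inr ⟨s, l, u, h₁, h₂⟩)))
  · exact Or.inr (mem_seq.2 (Or.inr (Or.inr ⟨s, l, u, h₁, h₂⟩)))

/-- After `abort` every continuation is already allowed, so a further command adds nothing. -/
theorem seq_abort_seq_le (c d : Cmd S) : (c.seq abort).seq d ≤ c.seq abort := by
  intro t ht
  rcases mem_seq.1 ht with ⟨h₁, -⟩ | ⟨s, l, h₁, h₂⟩ | ⟨s, l, u, h₁, -, -, rfl⟩
  · exact h₁
  · exact abort_closed _ s l h₁ t h₂
  · rcases mem_seq.1 h₁ with ⟨-, h⟩ | ⟨s', m, h, hp⟩ | ⟨s', m, v, h, -, hv, hl⟩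
    · exact absurd rfl h
    · exact mem_seq.2 (Or.inr (Or.inl ⟨s', m, h, (hasPrefix_prepend_self s l u).trans hp⟩))
    · cases v with
      | inf _ _ => cases hl
      | fin s₁ k st =>
        cases hl
        exact mem_seq.2 (Or.inr (Or.inr ⟨s, m, prepend (finalState s m) k u, h, trivial,
          start_prepend _ _ _, by cases u <;> simp [prepend]⟩))

/-- Non-aborted traces are iterations of arbitrary steps. Abortion can only be entered through an
environment transition outside `r`, and once it is entered everything is allowed. -/
theorem mem_rely {r : Set (S × S)} {t : Trace S} :
    t ∈ (rely r).traces ↔ t.NotAborted ∨ ¬ t.Steps (EnvIn r) := by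
  constructor
  · intro ht
    by_contra! hn
    obtain ⟨h₁, h₂⟩ := hn
    obtain ⟨s, l, rfl⟩ := not_notAborted.1 h₁
    clear h₁
    have key : ∀ {t : Trace S}, t ∈ (rely r).traces →
        (∃ s st, st ≠ Status.aborted ∧ t = fin s [] st) ∨
        ∃ s a u, u.start = a.2 ∧ t = prepend s [a] u ∧
          (u ∈ (rely r).traces ∨ ¬ EnvIn r s a) := by
      intro t ht
      rw [rely, iter_eq] at ht
      rcases ht with ht | ht
      · exact Or.inl (mem_nil.1 ht)
      · rcases mem_sup_seq ht with ht | ht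
        · rcases (isStep_cstep _).mem_seq ht with ⟨s, rfl⟩ | ⟨s, a, u, -, hu, hm, rfl⟩
          · exact Or.inl ⟨s, _, by simp, rfl⟩
          · exact Or.inr ⟨s, a, u, hu, rfl, Or.inl hm⟩
        · rcases (isStep_atomic _ _).mem_seq (seq_abort_seq_le _ _ ht) with
            ⟨s, rfl⟩ | ⟨s, a, u, h, hu, -, rfl⟩
          · exact Or.inl ⟨s, _, by simp, rfl⟩
          · exact Or.inr ⟨s, a, u, hu, rfl, Or.inr fun h' => h.2 (h' h.1)⟩
    induction l generalizing s with
    | nil =>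
      rcases key ht with ⟨_, _, h, h'⟩ | ⟨_, _, u, _, h', _⟩
      · cases h'; exact h rfl
      · cases u <;> cases h'
    | cons b l ih =>
      rcases key ht with ⟨_, _, h, h'⟩ | ⟨_, a, u, hu, h', h⟩
      · cases h'
      · rw [h', steps_cons hu] at h₂
        rcases h with h | h
        · cases u with
          | inf _ _ => cases h'
          | fin s₁ m st =>
            cases h'
            exact ih _ h h₂.2
        · exact h h₂.1
  · rintro (h | h)
    · refine iter_mono le_sup_left ((isStep_cstep Set.univ).mem_iter.2 ⟨h, ?_⟩)
      exact fun _ _ _ _ => trivial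
    · simp only [Steps, not_forall] at h
      obtain ⟨s, l, a, hp, hn⟩ := h
      rw [rely]
      induction l generalizing s t with
      | nil =>
        rw [iter_eq]
        -- The violating transition followed by an immediate abort is a trace, and abort closure
        -- yields all its extensions.
        refine Or.inr (mem_seq.2 (Or.inr (Or.inl ⟨s, [a], Or.inr ?_, hp⟩)))
        simp only [EnvIn, Classical.not_imp] at hn
        exact prepend_mem_seq (u := fin a.2 [] Status.aborted)
          ((isStep_atomic _ _).terminated_mem hn) trivial rfl
      | cons b l ih =>
        rcases eq_nil_or_cons t with ⟨s, st, rfl⟩ | ⟨s, c, u, hu, rfl⟩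
        · obtain ⟨-, hp⟩ := hp
          simp at hp
        · obtain ⟨rfl, rfl, hk⟩ := HasPrefix.of_cons hp
          rw [iter_eq]
          refine Or.inr (prepend_mem_seq (Or.inl ((isStep_cstep _).terminated_mem trivial))
            (ih _ hk ?_) hu)
          rwa [hu]

theorem mem_conj {c d : Cmd S} {t : Trace S} : t ∈ (c.conj d).traces ↔
    (t ∈ c.traces ∧ t ∈ d.traces) ∨ ∃ s l, t.HasPrefix s l ∧
      ((fin s l Status.aborted ∈ c.traces ∧ fin s l Status.incomplete ∈ d.traces) ∨
       (fin s l Status.incomplete ∈ c.traces ∧ fin s l Status.aborted ∈ d.traces)) := Iff.rfl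

/-- Since `rely r` accepts every non-aborted trace, it restricts `c` nowhere; it only contributes
its own abortion after a violation that `c` can reach. -/
theorem mem_rely_conj {r : Set (S × S)} {c : Cmd S} {t : Trace S} :
    t ∈ ((rely r).conj c).traces ↔ t ∈ c.traces ∨ ∃ s l, t.HasPrefix s l ∧
      ¬ (fin s l Status.incomplete).Steps (EnvIn r) ∧ fin s l Status.incomplete ∈ c.traces := by
  simp only [mem_conj, mem_rely]
  constructor
  · rintro (⟨-, h⟩ | ⟨s, l, hp, ⟨h₁ | h₁, h₂⟩ | ⟨-, h⟩⟩)
    · exact Or.inl h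
    · exact absurd rfl h₁
    · exact Or.inr ⟨s, l, hp, fun h => h₁ (h.of_hasPrefix (hasPrefix_fin_self _ _ _) _), h₂⟩
    · exact Or.inl (c.abort_closed s l h t hp)
  · rintro (h | ⟨s, l, hp, h₁, h₂⟩)
    · by_cases ht : t.NotAborted
      · exact Or.inl ⟨Or.inl ht, h⟩
      · obtain ⟨s, l, rfl⟩ := not_notAborted.1 ht
        exact Or.inr ⟨s, l, hasPrefix_fin_self _ _ _, Or.inr ⟨Or.inl (by simp [NotAborted]), h⟩⟩
    · exact Or.inr ⟨s, l, hp, Or.inl ⟨Or.inr fun h =>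
        h₁ (h.of_hasPrefix (hasPrefix_fin_self _ _ _) _), h₂⟩⟩

/-- All the states of the trace are in `I`. -/
def Within (I : Set S) (t : Trace S) : Prop := t.start ∈ I ∧ t.Steps fun _ a => a.2 ∈ I

theorem Within.of_hasPrefix {I : Set S} {t : Trace S} (h : Within I t) {s : S}
    {l : List (Step S)} (hl : t.HasPrefix s l) (st : Status) : Within I (fin s l st) :=
  ⟨hasPrefix_start hl ▸ h.1, h.2.of_hasPrefix hl st⟩

theorem mem_assert {p : Set S} {t : Trace S} : t ∈ (assert p).traces ↔
    t ∈ (nil : Cmd S).traces ∨ t.start ∉ p := by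
  rw [assert, mem_sup]
  refine or_congr_right' fun hn => ⟨fun ht => ?_, fun h => ?_⟩
  · rcases mem_seq.1 ht with ⟨⟨s, rfl | ⟨h, rfl⟩⟩, h₂⟩ | ⟨s, l, ⟨s', h | ⟨-, h⟩⟩, -⟩ |
      ⟨s, l, u, ⟨s', h | ⟨h', h⟩⟩, -, hu, rfl⟩
    · exact absurd (mem_nil.2 ⟨s, _, by simp, rfl⟩) hn
    · exact h
    · cases h
    · cases h
    · cases h
    · cases h
      rwa [start_prepend]
  · have := prepend_mem_seq (c := test pᶜ) (d := abort) (s := t.start) (l := []) (u := t)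
      ⟨_, Or.inr ⟨h, rfl⟩⟩ trivial rfl
    cases t <;> exact this

theorem mem_inv {I : Set S} {t : Trace S} :
    t ∈ (inv I).traces ↔ t.start ∉ I ∨ (t.NotAborted ∧ Within I t) := by
  have hiter : ∀ u : Trace S, u ∈ (cstep (postRel I)).iter.traces ↔
    u.NotAborted ∧ u.Steps fun _ a => a.2 ∈ I := fun u => (isStep_cstep _).mem_iter
  rw [inv, mem_seq]
  by_cases hs : t.start ∈ I
  · constructor
    · rintro (⟨h, h'⟩ | ⟨s, l, h, hp⟩ | ⟨s, l, u, h, hu, hus, rfl⟩)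
      · rcases mem_assert.1 h with h | h
        · obtain ⟨s, st, hst, rfl⟩ := mem_nil.1 h
          exact Or.inr ⟨hst, hs, steps_nil _ _ _⟩
        · exact absurd hs h
      · rcases mem_assert.1 h with h | h
        · obtain ⟨s, st, h, h'⟩ := mem_nil.1 h
          cases h'
          exact absurd rfl h
        · exact absurd (hasPrefix_start hp ▸ hs) h
      · rw [start_prepend] at hs
        rcases mem_assert.1 h with h | h
        · obtain ⟨s, st, h, h'⟩ := mem_nil.1 h
          cases h'
          rw [hiter] at hu
          exact Or.inr ⟨notAborted_prepend.2 hu.1, by rwa [start_prepend],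
            (steps_prepend hus Status.incomplete).2 ⟨steps_nil _ _ _, hu.2⟩⟩
        · exact absurd hs h
    · rintro (h | ⟨h, h'⟩)
      · exact absurd hs h
      · refine Or.inr (Or.inr ⟨t.start, [], t, mem_assert.2 (Or.inl (mem_nil.2
          ⟨_, _, by simp, rfl⟩)), (hiter t).2 ⟨h, h'.2⟩, rfl, by cases t <;> rfl⟩)
  · refine iff_of_true (Or.inr (Or.inl ⟨t.start, [], mem_assert.2 (Or.inr hs),
      hasPrefix_nil t⟩)) (Or.inl hs)

/-- From a state outside `I` both conjunctions allow everything; from a state in `I` the invariant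
never aborts and only filters. -/
theorem dataReifies_iff {I : Set S} {c d : Cmd S} :
    DataReifies I c d ↔ ∀ t, Within I t → t ∈ d.traces → t ∈ c.traces := by
  constructor
  · intro h t ht hd
    have : t ∈ ((inv I).conj d).traces := by
      -- `inv I` has no aborted trace from `I`, so an aborted trace enters the conjunction through
      -- the abort clause, with `inv I` supplying the incomplete trace.
      by_cases ha : t.NotAborted
      · exact Or.inl ⟨mem_inv.2 (Or.inr ⟨ha, ht⟩), hd⟩
      · obtain ⟨s, l, rfl⟩ := not_notAborted.1 ha
        exact Or.inr ⟨s, l, hasPrefix_fin_self _ _ _, Or.inr ⟨mem_inv.2 (Or.inr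
          ⟨by simp [NotAborted], ht.of_hasPrefix (hasPrefix_fin_self _ _ _) _⟩), hd⟩⟩
    rcases h this with ⟨-, h⟩ | ⟨s, l, hp, ⟨h, -⟩ | ⟨-, h⟩⟩
    · exact h
    · rcases mem_inv.1 h with h | ⟨h, -⟩
      · exact absurd (hasPrefix_start hp ▸ ht.1) h
      · exact absurd rfl h
    · exact c.abort_closed s l h t hp
  · intro h t ht
    have out : ∀ {t : Trace S}, t.start ∉ I → t ∈ ((inv I).conj c).traces := fun {t} ht =>
      Or.inr ⟨t.start, [], hasPrefix_nil t, Or.inl ⟨mem_inv.2 (Or.inl ht), c.empty_mem _⟩⟩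
    rcases ht with ⟨h₁, h₂⟩ | ⟨s, l, hp, ⟨h₁, h₂⟩ | ⟨h₁, h₂⟩⟩
    · rcases mem_inv.1 h₁ with h' | ⟨-, h'⟩
      · exact out h'
      · exact Or.inl ⟨h₁, h t h' h₂⟩
    · rcases mem_inv.1 h₁ with h' | ⟨h', -⟩
      · exact out (hasPrefix_start hp ▸ h')
      · exact absurd rfl h'
    · rcases mem_inv.1 h₁ with h' | ⟨-, h'⟩
      · exact out (hasPrefix_start hp ▸ h')
      · exact Or.inr ⟨s, l, hp, Or.inr ⟨h₁, h _
          (h'.of_hasPrefix (hasPrefix_fin_self _ _ _) _) h₂⟩⟩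

end Cmd

/-! ### Regular traces and compositional refinement -/

namespace Cmd

open Trace

/-- The trace stays within `I`, and ends, as an incomplete trace, with the first transition of the
environment that is not in `r`, if there is one. -/
def Regular (I : Set S) (r : Set (S × S)) (t : Trace S) : Prop :=
  Within I t ∧ ∀ s l, t.HasPrefix s l → ¬ (fin s l Status.incomplete).Steps (EnvIn r) →
    t = fin s l Status.incomplete

theorem Regular.of_hasPrefix {I : Set S} {r : Set (S × S)} {t : Trace S} (h : Regular I r t)
    {s : S} {l : List (Step S)} (hp : t.HasPrefix s l) :
    Regular I r (fin s l Status.incomplete) := by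
  refine ⟨h.1.of_hasPrefix hp _, fun s' m hm hn => ?_⟩
  rw [h.2 s' m (hp.trans hm) hn] at hp
  obtain ⟨rfl, hp⟩ := hp
  rw [hp.eq_of_length_le hm.2.length_le]

/-- Either the prefix has no violation, and then its status is immaterial, or it ends the trace.
Only an incomplete regular trace can contain a violation. -/
theorem Regular.of_hasPrefix_or_eq {I : Set S} {r : Set (S × S)} {t : Trace S} (h : Regular I r t)
    {s : S} {l : List (Step S)} (hp : t.HasPrefix s l) :
    (∀ st, Regular I r (fin s l st)) ∨ t = fin s l Status.incomplete := by
  by_cases hs : (fin s l Status.incomplete).Steps (EnvIn r)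
  · exact Or.inl fun st => ⟨h.1.of_hasPrefix hp _, fun s' m hm hn =>
      absurd (hs.of_hasPrefix hm _) hn⟩
  · exact Or.inr (h.2 s l hp hs)

theorem Regular.of_prepend {I : Set S} {r : Set (S × S)} {s : S} {l : List (Step S)}
    {u : Trace S} (h : Regular I r (prepend s l u)) (hu : u.start = finalState s l) :
    Regular I r u := by
  have hstart : finalState s l ∈ I := by
    rcases List.eq_nil_or_concat l with rfl | ⟨l', a, rfl⟩
    · exact start_prepend s [] u ▸ h.1.1
    · rw [List.concat_eq_append] at h ⊢
      rw [finalState_append]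
      exact h.1.2 s l' a (hasPrefix_prepend_self s _ u)
  refine ⟨⟨hu ▸ hstart, ((steps_prepend hu Status.incomplete).1 h.1.2).2⟩, fun s' m hm hn => ?_⟩
  obtain rfl := hasPrefix_start hm
  have hpre : prepend s l (fin u.start m Status.incomplete) =
    fin s (l ++ m) Status.incomplete := rfl
  have := h.2 s (l ++ m) (hm.prepend s l) fun hs => hn
    ((steps_prepend (u := fin u.start m Status.incomplete) hu Status.incomplete).1 hs).2
  exact prepend_inj (by rfl) (this.trans hpre.symm)

/-- Refinement of the behaviours that are regular for `I` and `r`. -/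
def RegularRefines (I : Set S) (r : Set (S × S)) (c d : Cmd S) : Prop :=
  ∀ t, Regular I r t → t ∈ d.traces → t ∈ c.traces

theorem DataReifies.regularRefines {I : Set S} {c d : Cmd S}
    (h : DataReifies I c d) (r : Set (S × S)) : RegularRefines I r c d :=
  fun t ht => dataReifies_iff.1 h t ht.1

/-- The source of a transition is the initial state or the target of the preceding transition, so it
lies in `I` as well. -/
theorem Within.envIn {I : Set S} {r₁ r₂ : Set (S × S)} (hr : preRel I ∩ r₁ ∩ postRel I ⊆ r₂)
    {t : Trace S} (ht : Within I t) (h : t.Steps (EnvIn r₁)) : t.Steps (EnvIn r₂) := by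
  intro s l a hp ha
  refine hr ⟨⟨?_, h s l a hp ha⟩, ht.2 s l a hp⟩
  rcases List.eq_nil_or_concat l with rfl | ⟨l', b, rfl⟩
  · exact hasPrefix_start hp ▸ ht.1
  · rw [List.concat_eq_append] at hp ⊢
    rw [finalState_append]
    exact ht.2 s l' b (hp.mono (List.prefix_append _ _))

/-- Without a violation of `r₁` the trace is itself regular. Otherwise its shortest violating prefix
is regular, and a trace of `c` ending there lets `rely r₁` abort and accept the whole trace. -/
theorem RegularRefines.dataReifies {I : Set S} {r₁ r₂ : Set (S × S)}
    (hr : preRel I ∩ r₁ ∩ postRel I ⊆ r₂) {c d : Cmd S} (h : RegularRefines I r₁ c d) :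
    DataReifies I ((rely r₁).conj c) ((rely r₂).conj d) := by
  rw [dataReifies_iff]
  intro t ht hd
  rw [mem_rely_conj] at hd ⊢
  by_cases hs : t.Steps (EnvIn r₁)
  · refine Or.inl (h t ⟨ht, fun s l hp hn => absurd (hs.of_hasPrefix hp _) hn⟩ ?_)
    rcases hd with hd | ⟨s, l, hp, hn, -⟩
    · exact hd
    · exact absurd ((ht.envIn hr hs).of_hasPrefix hp _) hn
  · classical
    have hex : ∃ n s l, l.length = n ∧ t.HasPrefix s l ∧
        ¬ (fin s l Status.incomplete).Steps (EnvIn r₁) := by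
      obtain ⟨s, l, hp, hn⟩ := exists_not_steps hs
      exact ⟨_, s, l, rfl, hp, hn⟩
    obtain ⟨s, l, hl, hp, hn⟩ := Nat.find_spec hex
    have hmin : ∀ s' m, t.HasPrefix s' m → ¬ (fin s' m Status.incomplete).Steps (EnvIn r₁) →
        s = s' ∧ l <+: m := by
      intro s' m hm hn'
      have hle := Nat.find_min' hex ⟨s', m, rfl, hm, hn'⟩
      obtain ⟨rfl, h' | h'⟩ := hp.total hm
      · exact ⟨rfl, h'⟩
      · exact ⟨rfl, (h'.eq_of_length_le (hl ▸ hle)) ▸ List.prefix_refl _⟩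
    refine Or.inr ⟨s, l, hp, hn, h _ ⟨ht.of_hasPrefix hp _, fun s' m hm hn' => ?_⟩ ?_⟩
    · obtain ⟨rfl, h'⟩ := hmin s' m (hp.trans hm) hn'
      rw [h'.eq_of_length_le hm.2.length_le]
    · rcases hd with hd | ⟨s', m, hm, hn', hd⟩
      · exact mem_of_hasPrefix hd hp
      -- A prefix violating `r₂` violates `r₁` too, so it extends the shortest prefix violating
      -- `r₁`.
      · obtain ⟨rfl, h'⟩ := hmin s' m hm fun h' =>
          hn' ((ht.of_hasPrefix hm _).envIn hr h')
        exact mem_of_hasPrefix hd ⟨rfl, h'⟩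

theorem RegularRefines.mem_seq {I : Set S} {r : Set (S × S)} {c c' d d' : Cmd S}
    (h : RegularRefines I r c c') (h' : ∀ u, Regular I r u → u ∈ d'.traces → u ∈ d.traces)
    {t : Trace S} (ht : Regular I r t) (hm : t ∈ (c'.seq d').traces) :
    t ∈ (c.seq d).traces := by
  rw [Cmd.mem_seq] at hm ⊢
  -- The case where the first command already meets the violation: the trace ends there, so the
  -- second command plays no part.
  have inc : ∀ s l st, t = fin s l Status.incomplete → fin s l st ∈ c'.traces →
      t ∈ c.traces ∧ t.NonTerminated := by
    rintro s l st rfl hm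
    exact ⟨h _ ht (mem_of_hasPrefix hm (hasPrefix_fin_self _ _ _)), by simp [NonTerminated]⟩
  rcases hm with ⟨hm, hn⟩ | ⟨s, l, hm, hp⟩ | ⟨s, l, u, hm, hu, hus, rfl⟩
  · exact Or.inl ⟨h t ht hm, hn⟩
  · rcases ht.of_hasPrefix_or_eq hp with hp' | hp'
    · exact Or.inr (Or.inl ⟨s, l, h _ (hp' _) hm, hp⟩)
    · exact Or.inl (inc s l _ hp' hm)
  · rcases ht.of_hasPrefix_or_eq (hasPrefix_prepend_self s l u) with hp' | hp'
    · exact Or.inr (Or.inr ⟨s, l, u, h _ (hp' _) hm, h' u (ht.of_prepend hus) hu, hus, rfl⟩)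
    · exact Or.inl (inc s l _ hp' hm)

theorem RegularRefines.seq {I : Set S} {r : Set (S × S)} {c c' d d' : Cmd S}
    (h : RegularRefines I r c c') (h' : RegularRefines I r d d') :
    RegularRefines I r (c.seq d) (c'.seq d') :=
  fun _ ht => h.mem_seq h' ht

theorem RegularRefines.sup {I : Set S} {r : Set (S × S)} {c c' d d' : Cmd S}
    (h : RegularRefines I r c c') (h' : RegularRefines I r d d') :
    RegularRefines I r (c ⊔ d) (c' ⊔ d') :=
  fun t ht => Or.imp (h t ht) (h' t ht)

theorem RegularRefines.refl (I : Set S) (r : Set (S × S)) (c : Cmd S) : RegularRefines I r c c :=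
  fun _ _ h => h

/-- The least command with the behaviours of `c` that are regular for `I` and `r`. -/
def regularPart (I : Set S) (r : Set (S × S)) (c : Cmd S) : Cmd S where
  traces := {t | (∃ s, t = fin s [] Status.incomplete) ∨ (Regular I r t ∧ t ∈ c.traces) ∨
    ∃ s l, t.HasPrefix s l ∧ Regular I r (fin s l Status.aborted) ∧
      fin s l Status.aborted ∈ c.traces}
  empty_mem s := Or.inl ⟨s, rfl⟩
  prefix_closed := by
    rintro t (⟨s, rfl⟩ | ⟨h₁, h₂⟩ | ⟨s, l, hp, h₁, h₂⟩) s' m hm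
    · obtain ⟨rfl, hm⟩ := hm
      obtain rfl := List.prefix_nil.1 hm
      exact Or.inl ⟨_, rfl⟩
    · exact Or.inr (Or.inl ⟨h₁.of_hasPrefix hm, mem_of_hasPrefix h₂ hm⟩)
    · obtain ⟨rfl, h | h⟩ := hp.total hm
      · exact Or.inr (Or.inr ⟨s, l, ⟨rfl, h⟩, h₁, h₂⟩)
      · exact Or.inr (Or.inl ⟨h₁.of_hasPrefix ⟨rfl, h⟩, mem_of_hasPrefix h₂ ⟨rfl, h⟩⟩)
  abort_closed := by
    rintro s l (⟨s, h⟩ | ⟨h₁, h₂⟩ | ⟨s', m, hp, h₁, h₂⟩) t ht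
    · cases h
    · exact Or.inr (Or.inr ⟨s, l, ht, h₁, h₂⟩)
    · exact Or.inr (Or.inr ⟨s', m, ht.trans hp, h₁, h₂⟩)

/-- Coinduction needs a command, and the regular traces of `d.iter` alone need not be one;
`regularPart` adds the trivial traces and the extensions of regular aborted traces. -/
theorem RegularRefines.iter {I : Set S} {r : Set (S × S)} {c d : Cmd S}
    (h : RegularRefines I r c d) : RegularRefines I r c.iter d.iter := by
  suffices hle : regularPart I r d.iter ≤ c.iter from
    fun t ht hd => hle (Or.inr (Or.inl ⟨ht, hd⟩))
  have key : ∀ t, Regular I r t → t ∈ d.iter.traces →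
      t ∈ (nil ⊔ c.seq (regularPart I r d.iter)).traces := by
    intro t ht hd
    rw [iter_eq] at hd
    rcases hd with hd | hd
    · exact Or.inl hd
    · exact Or.inr (h.mem_seq (d := regularPart I r d.iter) (fun u hu hud => Or.inr (Or.inl ⟨hu, hud⟩)) ht hd)
  apply le_iter
  rintro t (⟨s, rfl⟩ | ⟨h₁, h₂⟩ | ⟨s, l, hp, h₁, h₂⟩)
  · exact Cmd.empty_mem _ _
  · exact key t h₁ h₂
  · exact abort_closed _ s l (key _ h₁ h₂) t hp

end Cmd

/-! ### Idle traces and their parallel composition -/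

namespace Trace

/-- From some point on, all transitions are made by the environment. -/
def EventuallyEnv (t : Trace S) : Prop :=
  ∃ n, ∀ s l a, t.HasPrefix s (l ++ [a]) → n ≤ l.length → a.1 = Kind.env

theorem eventuallyEnv_fin (s : S) (l : List (Step S)) (st : Status) :
    (fin s l st).EventuallyEnv := by
  refine ⟨l.length, ?_⟩
  rintro s' m a ⟨-, h⟩ hl
  have := h.length_le
  simp at this
  omega

theorem EventuallyEnv.prepend {t : Trace S} (h : t.EventuallyEnv) (s : S) (l : List (Step S)) :
    (prepend s l t).EventuallyEnv := by
  obtain ⟨n, hn⟩ := h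
  refine ⟨l.length + n, fun s' m a hm hl => ?_⟩
  obtain ⟨-, hm | ⟨k, hk, hp⟩⟩ := hasPrefix_prepend hm
  · have := hm.length_le
    simp at this
    omega
  · have hlen := congrArg List.length hk
    rcases List.eq_nil_or_concat k with rfl | ⟨k, b, rfl⟩
    · simp at hlen
      omega
    · rw [List.concat_eq_append] at hk hp
      rw [← List.append_assoc] at hk
      obtain ⟨rfl, hb⟩ := List.append_inj' hk rfl
      obtain rfl : a = b := by simpa using hb
      simp only [List.length_append] at hl
      exact hn _ k a hp (by omega)

/-- The transition leaves the state unchanged, if it is made by the program. -/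
def Stutter (s : S) (a : Step S) : Prop := a.1 = Kind.pgm → a.2 = s

/-- A behaviour that may wait for the environment but does not change the state. -/
def Idle (t : Trace S) : Prop := t.NotAborted ∧ t.Steps Stutter ∧ t.EventuallyEnv

theorem idle_nil (s : S) : (fin s [] Status.incomplete).Idle :=
  ⟨by simp [NotAborted], steps_nil _ _ _, eventuallyEnv_fin _ _ _⟩

theorem Idle.of_hasPrefix {t : Trace S} (h : t.Idle) {s : S} {l : List (Step S)}
    (hp : t.HasPrefix s l) {st : Status} (hst : st ≠ Status.aborted) : (fin s l st).Idle :=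
  ⟨hst, h.2.1.of_hasPrefix hp _, eventuallyEnv_fin _ _ _⟩

/-- The behaviour of a parallel component that leaves all the transitions to its environment. -/
def toEnv : Trace S → Trace S
  | fin s l st => fin s (l.map fun a => (Kind.env, a.2)) st
  | inf s f => inf s (f.map fun a => (Kind.env, a.2))

theorem HasPrefix.of_toEnv {t : Trace S} {s : S} {l : List (Step S)} {a : Step S}
    (h : t.toEnv.HasPrefix s (l ++ [a])) : a.1 = Kind.env := by
  cases t with
  | fin s' m st =>
    have := h.2.subset (List.mem_append_right l (List.mem_singleton_self a))
    obtain ⟨b, -, rfl⟩ := List.mem_map.1 this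
    rfl
  | inf s' f =>
    obtain ⟨-, g, h⟩ := h
    have := congrArg (fun f => f.get l.length) h
    simp [Stream'.get_map, Stream'.get_append_length] at this
    rw [← this]

theorem Idle.toEnv {t : Trace S} (h : t.Idle) : t.toEnv.Idle := by
  refine ⟨?_, fun s l a hp ha => ?_, 0, fun s l a hp _ => hp.of_toEnv⟩
  · cases t
    · exact h.1
    · trivial
  · rw [hp.of_toEnv] at ha
    cases ha

/-- The set of states of a finite trace. -/
def visited (s : S) (l : List (Step S)) : Set S := {σ | ∃ m, m <+: l ∧ finalState s m = σ}

end Trace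

namespace Cmd

open Trace

theorem ParSteps.eq {l₁ l₂ l : List (Step S)} (h : ParSteps l₁ l₂ l) :
    l₁.map Prod.snd = l.map Prod.snd ∧ l₂.map Prod.snd = l.map Prod.snd := by
  induction l generalizing l₁ l₂ with
  | nil => rcases l₁ with _ | ⟨a, l₁⟩ <;> rcases l₂ with _ | ⟨b, l₂⟩ <;> first | exact h.elim | simp
  | cons c l ih =>
    rcases l₁ with _ | ⟨a, l₁⟩ <;> rcases l₂ with _ | ⟨b, l₂⟩ <;> try exact h.elim
    obtain ⟨⟨h₁, h₂, -⟩, h⟩ := h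
    simp [h₁, h₂, ih h]

theorem finalState_congr {s : S} {l m : List (Step S)} (h : l.map Prod.snd = m.map Prod.snd) :
    finalState s l = finalState s m := by
  induction l generalizing s m with
  | nil =>
    obtain rfl : m = [] := by simpa using h
    rfl
  | cons a l ih =>
    rcases m with _ | ⟨b, m⟩
    · cases h
    · obtain ⟨hab, h⟩ := List.cons_eq_cons.1 h
      change finalState a.2 l = finalState b.2 m
      rw [show a.2 = b.2 from hab]
      exact ih h

/-- Only the targets of transitions matter, not who makes them; parallel components therefore visit
the same states. -/
theorem visited_congr {s : S} {l m : List (Step S)} (h : l.map Prod.snd = m.map Prod.snd) :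
    visited s l = visited s m := by
  have key : ∀ {l m : List (Step S)}, l.map Prod.snd = m.map Prod.snd →
      visited s l ⊆ visited s m := by
    rintro l m h _ ⟨k, ⟨k', rfl⟩, rfl⟩
    refine ⟨m.take k.length, List.take_prefix _ _, finalState_congr ?_⟩
    rw [List.map_take, ← h, ← List.map_take, List.take_left]
  exact (key h).antisymm (key h.symm)

theorem ParSteps.append_singleton {l₁ l₂ l : List (Step S)} {a : Step S}
    (h : ParSteps l₁ l₂ (l ++ [a])) :
    ∃ m₁ m₂ a₁ a₂, l₁ = m₁ ++ [a₁] ∧ l₂ = m₂ ++ [a₂] ∧ ParSteps m₁ m₂ l ∧ ParStep a₁ a₂ a := by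
  induction l generalizing l₁ l₂ with
  | nil =>
    rcases l₁ with _ | ⟨a₁, l₁⟩ <;> rcases l₂ with _ | ⟨a₂, l₂⟩ <;> try exact h.elim
    obtain ⟨h₁, h₂⟩ := h
    rcases l₁ with _ | ⟨b₁, l₁⟩ <;> rcases l₂ with _ | ⟨b₂, l₂⟩ <;> try exact h₂.elim
    exact ⟨[], [], a₁, a₂, rfl, rfl, trivial, h₁⟩
  | cons c l ih =>
    rcases l₁ with _ | ⟨b₁, l₁⟩ <;> rcases l₂ with _ | ⟨b₂, l₂⟩ <;> try exact h.elim
    obtain ⟨h₁, h⟩ := h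
    obtain ⟨m₁, m₂, a₁, a₂, rfl, rfl, h, h'⟩ := ih h
    exact ⟨b₁ :: m₁, b₂ :: m₂, a₁, a₂, rfl, rfl, ⟨h₁, h⟩, h'⟩

/-- A program transition of the composition belongs to one component, where it stutters. Once both
components make only environment transitions, so does the composition. -/
theorem ParTrace.idle {t₁ t₂ t : Trace S} (h : ParTrace t₁ t₂ t) (h₁ : t₁.Idle) (h₂ : t₂.Idle) :
    t.Idle := by
  have key : ∀ s l a, t.HasPrefix s (l ++ [a]) → ∃ m₁ m₂ a₁ a₂, t₁.HasPrefix s (m₁ ++ [a₁]) ∧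
      t₂.HasPrefix s (m₂ ++ [a₂]) ∧ m₁.map Prod.snd = l.map Prod.snd ∧
      m₂.map Prod.snd = l.map Prod.snd ∧ ParStep a₁ a₂ a := by
    intro s l a hp
    obtain ⟨l₁, l₂, hp₁, hp₂, hl⟩ := h.split hp
    obtain ⟨m₁, m₂, a₁, a₂, rfl, rfl, hl, ha⟩ := hl.append_singleton
    exact ⟨m₁, m₂, a₁, a₂, hp₁, hp₂, hl.eq.1, hl.eq.2, ha⟩
  refine ⟨?_, fun s l a hp ha => ?_, ?_⟩
  · cases t with
    | inf _ _ => trivial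
    | fin s l st =>
      cases t₁ <;> cases t₂ <;> try exact h.elim
      obtain ⟨-, -, rfl, -⟩ := h
      exact h₁.1
  · obtain ⟨m₁, m₂, a₁, a₂, hp₁, hp₂, hm₁, hm₂, e₁, e₂, h | h | h⟩ := key s l a hp
    · rw [← e₁, ← finalState_congr hm₁]
      exact h₁.2.1 s m₁ a₁ hp₁ h.1
    · rw [← e₂, ← finalState_congr hm₂]
      exact h₂.2.1 s m₂ a₂ hp₂ h.2.1
    · rw [h.2.2] at ha
      cases ha
  · obtain ⟨n₁, hn₁⟩ := h₁.2.2
    obtain ⟨n₂, hn₂⟩ := h₂.2.2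
    refine ⟨max n₁ n₂, fun s l a hp hl => ?_⟩
    obtain ⟨m₁, m₂, a₁, a₂, hp₁, hp₂, hm₁, hm₂, e₁, e₂, h⟩ := key s l a hp
    replace hm₁ := congrArg List.length hm₁
    replace hm₂ := congrArg List.length hm₂
    simp only [List.length_map] at hm₁ hm₂
    have h₁ := hn₁ s m₁ a₁ hp₁ (by omega)
    have h₂ := hn₂ s m₂ a₂ hp₂ (by omega)
    rw [h₁, h₂] at h
    simpa using h

theorem parStep_toEnv (a : Step S) : ParStep a (Kind.env, a.2) a := by
  rcases a with ⟨_ | _, s⟩ <;> simp [ParStep]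

/-- Any trace splits in parallel by giving one component all the program transitions. -/
theorem parTrace_toEnv (t : Trace S) : ParTrace t t.toEnv t := by
  cases t with
  | fin s l st =>
    refine ⟨rfl, rfl, rfl, rfl, ?_⟩
    induction l with
    | nil => trivial
    | cons a l ih => exact ⟨parStep_toEnv a, ih⟩
  | inf s f => exact ⟨rfl, rfl, fun n => parStep_toEnv _⟩

/-- The finite non-aborted traces form a pre-fixed point, so the least fixed point contains no
infinite trace. -/
theorem mem_finIter_cstep {t : Trace S} (ht : t ∈ (cstep Set.univ).finIter.traces) :
    t.NotAborted ∧ t.EventuallyEnv := by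
  let d : Cmd S :=
    { traces := {t | ∃ s l st, st ≠ Status.aborted ∧ t = fin s l st}
      empty_mem := fun s => ⟨s, [], _, by simp, rfl⟩
      prefix_closed := fun t _ s l _ => ⟨s, l, _, by simp, rfl⟩
      abort_closed := by
        rintro s l ⟨_, _, _, h, h'⟩
        cases h'
        exact absurd rfl h }
  have hle : (cstep Set.univ).finIter ≤ d := by
    apply finIter_le
    rintro t (ht | ht)
    · obtain ⟨s, st, h, rfl⟩ := mem_nil.1 ht
      exact ⟨s, [], st, h, rfl⟩
    · rcases (isStep_cstep _).mem_seq ht with ⟨s, rfl⟩ | ⟨s, a, u, -, -, ⟨s', l, st, h, rfl⟩, rfl⟩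
      · exact ⟨s, [], _, by simp, rfl⟩
      · exact ⟨s, _, st, h, rfl⟩
  obtain ⟨s, l, st, h, rfl⟩ := hle ht
  exact ⟨h, eventuallyEnv_fin _ _ _⟩

theorem terminated_mem_finIter_cstep (s : S) (l : List (Step S)) :
    fin s l Status.terminated ∈ (cstep Set.univ : Cmd S).finIter.traces := by
  induction l generalizing s with
  | nil =>
    rw [finIter_eq]
    exact Or.inl (mem_nil.2 ⟨s, _, by simp, rfl⟩)
  | cons a l ih =>
    rw [finIter_eq]
    exact Or.inr (prepend_mem_seq ((isStep_cstep Set.univ).terminated_mem (s := s) (a := a) trivial)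
      (ih a.2) rfl)

theorem mem_term {t : Trace S} : t ∈ (term : Cmd S).traces ↔ t.NotAborted ∧ t.EventuallyEnv := by
  have hiter : ∀ u : Trace S, u ∈ (estep (Set.univ : Set (S × S))).iter.traces ↔ _ :=
    fun u => (isStep_atomic _ _).mem_iter
  rw [term, mem_seq]
  constructor
  · rintro (⟨h, -⟩ | ⟨s, l, h, -⟩ | ⟨s, l, u, -, hu, -, rfl⟩)
    · exact mem_finIter_cstep h
    · exact absurd rfl (mem_finIter_cstep h).1
    · obtain ⟨h₁, h₂⟩ := (hiter u).1 hu
      exact ⟨notAborted_prepend.2 h₁,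
        EventuallyEnv.prepend ⟨0, fun s l a hp _ => (h₂ s l a hp).1⟩ s l⟩
  · rintro ⟨h, n, hn⟩
    cases t with
    | fin s l st =>
      refine Or.inr (Or.inr ⟨s, l, fin _ [] st, terminated_mem_finIter_cstep s l,
        (hiter _).2 ⟨h, steps_nil _ _ _⟩, rfl, by simp [prepend]⟩)
    | inf s f =>
      -- Cut at the bound `n`, after which only the environment acts.
      have hf : inf s f = prepend s (f.take n) (inf (finalState s (f.take n)) (f.drop n)) := by
        simp [prepend, Stream'.append_take_drop]
      refine Or.inr (Or.inr ⟨s, f.take n, inf _ (f.drop n), terminated_mem_finIter_cstep s _,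
        (hiter _).2 ⟨trivial, fun s' l a hp => ⟨?_, trivial⟩⟩, rfl, hf⟩)
      obtain rfl := hasPrefix_start hp
      refine hn s (f.take n ++ l) a ?_ (by simp)
      rw [hf, List.append_assoc]
      exact hp.prepend s (f.take n)

end Cmd

variable {Var : Type u} {Val : Var → Type}

/-! ### The idle command and a single atomic read -/

namespace Cmd

open Trace

theorem mem_idle {t : Trace (State Val)} : t ∈ (idle : Cmd (State Val)).traces ↔ t.Idle := by
  have hguar : ∀ u : Trace (State Val), u ∈ (guar (idOn (Val := Val) ∅ᶜ)).traces ↔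
      u.NotAborted ∧ u.Steps Stutter := by
    intro u
    refine Iff.trans ((isStep_atomic _ _).sup (isStep_atomic _ _)).mem_iter ?_
    refine and_congr_right' ⟨fun h => h.mono ?_, fun h => h.mono ?_⟩
    · rintro s ⟨k, s'⟩ (⟨-, h⟩ | ⟨h, -⟩) h'
      · exact funext fun v => h v (by simp)
      · exact absurd (h.symm.trans h') (by simp)
    · rintro s ⟨_ | _, s'⟩ h
      · exact Or.inl ⟨rfl, fun v _ => congrFun (h rfl) v⟩
      · exact Or.inr ⟨rfl, trivial⟩
  rw [idle, frame, mem_conj, hguar, mem_term]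
  constructor
  · rintro (⟨⟨h₁, h₂⟩, -, h₃⟩ | ⟨s, l, -, ⟨h, -⟩ | ⟨-, h⟩⟩)
    · exact ⟨h₁, h₂, h₃⟩
    · exact absurd rfl ((hguar _).1 h).1
    · exact absurd rfl (mem_term.1 h).1
  · rintro ⟨h₁, h₂, h₃⟩
    exact Or.inl ⟨⟨h₁, h₂⟩, h₁, h₃⟩

/-- A test adds no transitions and only filters final states. An aborting `c` would escape the
filter through abort closure. -/
theorem mem_seq_test {c : Cmd S} (hc : ∀ t ∈ c.traces, t.NotAborted) {p : Set S} {t : Trace S} :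
    t ∈ (c.seq (test p)).traces ↔
      t ∈ c.traces ∧ ∀ s l, t = fin s l Status.terminated → finalState s l ∈ p := by
  rw [mem_seq]
  constructor
  · rintro (⟨h, h'⟩ | ⟨s, l, h, -⟩ | ⟨s, l, u, h, ⟨s', rfl | ⟨hs, rfl⟩⟩, hu, rfl⟩)
    · exact ⟨h, by rintro s l rfl; exact absurd rfl h'⟩
    · exact absurd rfl (hc _ h)
    · exact ⟨mem_of_hasPrefix h ⟨rfl, by simp⟩, by simp [prepend]⟩
    · obtain rfl : s' = finalState s l := hu
      simp only [prepend, List.append_nil]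
      exact ⟨h, by rintro s' l' h'; cases h'; exact hs⟩
  · rintro ⟨h, h'⟩
    by_cases ht : ∃ s l, t = fin s l Status.terminated
    · obtain ⟨s, l, rfl⟩ := ht
      exact Or.inr (Or.inr ⟨s, l, fin (finalState s l) [] Status.terminated, h,
        ⟨_, Or.inr ⟨h' s l rfl, rfl⟩⟩, rfl, by simp [prepend]⟩)
    · refine Or.inl ⟨h, ?_⟩
      cases t with
      | inf _ _ => trivial
      | fin s l st => rintro rfl; exact ht ⟨s, l, rfl⟩

/-- Idle traces are closed under concatenation, and finite ones may be cut anywhere, so the test can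
be placed at any visited state. -/
theorem mem_idle_test_idle {p : Set (State Val)} {t : Trace (State Val)} :
    t ∈ ((idle : Cmd (State Val)).seq ((test p).seq idle)).traces ↔
      t.Idle ∧ ∀ s l, t = fin s l Status.terminated → ∃ σ ∈ visited s l, σ ∈ p := by
  have key : ∀ u : Trace (State Val), u ∈ ((test p).seq idle).traces →
      u.Idle ∧ ∀ s l, u = fin s l Status.terminated → s ∈ p := by
    intro u hu
    rcases mem_seq.1 hu with ⟨⟨s, rfl | ⟨-, rfl⟩⟩, h⟩ | ⟨s, l, ⟨s', h | ⟨-, h⟩⟩, -⟩ |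
      ⟨s, l, v, ⟨s', h | ⟨hs', h⟩⟩, hv, hvs, rfl⟩
    · exact ⟨idle_nil s, by simp⟩
    · exact absurd rfl h
    · cases h
    · cases h
    · cases h
    · cases h
      have hv' : prepend s [] v = v := by
        obtain rfl : v.start = s := hvs
        cases v <;> rfl
      rw [hv']
      exact ⟨mem_idle.1 hv, by rintro s' l rfl; obtain rfl : s' = s := hvs; exact hs'⟩
  rw [mem_seq]
  constructor
  · rintro (⟨h, h'⟩ | ⟨s, l, h, -⟩ | ⟨s, l, u, h, hu, hus, rfl⟩)
    · exact ⟨mem_idle.1 h, by rintro s l rfl; exact absurd rfl h'⟩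
    · exact absurd rfl (mem_idle.1 h).1
    · obtain ⟨h₁, h₂⟩ := key u hu
      refine ⟨⟨notAborted_prepend.2 h₁.1, (steps_prepend hus _).2 ⟨(mem_idle.1 h).2.1, h₁.2.1⟩,
        h₁.2.2.prepend s l⟩, fun s' m hm => ?_⟩
      cases u with
      | inf _ _ => cases hm
      | fin s₁ k st =>
        cases hm
        exact ⟨s₁, ⟨l, List.prefix_append _ _, hus.symm⟩, h₂ _ _ rfl⟩
  · rintro ⟨h, h'⟩
    by_cases ht : ∃ s l, t = fin s l Status.terminated
    · obtain ⟨s, l, rfl⟩ := ht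
      obtain ⟨_, ⟨m, ⟨k, rfl⟩, rfl⟩, hp⟩ := h' s l rfl
      have hu : (fin (finalState s m) k Status.terminated).start = finalState s m := rfl
      have hs := (steps_prepend hu Status.terminated).1 h.2.1
      exact Or.inr (Or.inr ⟨s, m, fin (finalState s m) k Status.terminated,
        mem_idle.2 ⟨by simp [NotAborted], hs.1, eventuallyEnv_fin _ _ _⟩,
        prepend_mem_seq (c := test p) (l := []) ⟨_, Or.inr ⟨hp, rfl⟩⟩
          (mem_idle.2 ⟨by simp [NotAborted], hs.2, eventuallyEnv_fin _ _ _⟩) rfl, rfl, rfl⟩)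
    · refine Or.inl ⟨mem_idle.2 h, ?_⟩
      cases t with
      | inf _ _ => trivial
      | fin s l st => rintro rfl; exact ht ⟨s, l, rfl⟩

end Cmd

/-! ### Evaluation of expressions under interference -/

namespace Expr

open Trace Cmd

/-- The expression may evaluate to `k` if each occurrence of a variable is read in some state of
`V`. -/
def Evaluates (V : Set (State Val)) : {α : Type} → Expr Val α → α → Prop
  | _, const a, k => ∃ _σ ∈ V, a = k
  | _, var x, k => ∃ σ ∈ V, σ x = k
  | _, unary f e, k => ∃ a, e.Evaluates V a ∧ f a = k
  | _, binary f e₁ e₂, k => ∃ a b, e₁.Evaluates V a ∧ e₂.Evaluates V b ∧ f a b = k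

theorem evaluates_value {V : Set (State Val)} {σ : State Val} (hσ : σ ∈ V) {α : Type}
    (e : Expr Val α) : e.Evaluates V (e.value σ) := by
  induction e with
  | const a => exact ⟨σ, hσ, rfl⟩
  | var x => exact ⟨σ, hσ, rfl⟩
  | unary f e ih => exact ⟨_, ih, rfl⟩
  | binary f e₁ e₂ ih₁ ih₂ => exact ⟨_, _, ih₁, ih₂, rfl⟩

/-- For a binary operator, take the state found for one operand; the other operand, being invariant,
has the same value there as in its own state. -/
theorem Evaluates.exists_value {V : Set (State Val)} {r : Set (State Val × State Val)}
    (hV : ∀ (α : Type) (e : Expr Val α), e.InvariantUnder r → ∀ σ ∈ V, ∀ σ' ∈ V,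
      e.value σ = e.value σ') {α : Type} {e : Expr Val α} {k : α}
    (he : e.SingleReference r) (h : e.Evaluates V k) : ∃ σ ∈ V, e.value σ = k := by
  induction e with
  | const a => exact h
  | var x => exact h
  | unary f e ih =>
    obtain ⟨a, h, rfl⟩ := h
    obtain ⟨σ, hσ, rfl⟩ := ih he h
    exact ⟨σ, hσ, rfl⟩
  | binary f e₁ e₂ ih₁ ih₂ =>
    obtain ⟨a, b, h₁, h₂, rfl⟩ := h
    obtain ⟨σ₁, hσ₁, rfl⟩ := ih₁ he.1 h₁
    obtain ⟨σ₂, hσ₂, rfl⟩ := ih₂ he.2.1 h₂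
    rcases he.2.2 with h | h
    · exact ⟨σ₂, hσ₂, by rw [hV _ e₁ h σ₁ hσ₁ σ₂ hσ₂]; rfl⟩
    · exact ⟨σ₁, hσ₁, by rw [hV _ e₂ h σ₂ hσ₂ σ₁ hσ₁]; rfl⟩

theorem mem_eval {α : Type} {e : Expr Val α} {k : α} {t : Trace (State Val)} :
    t ∈ (e.eval k).traces ↔
      t.Idle ∧ ∀ s l, t = fin s l Status.terminated → e.Evaluates (visited s l) k := by
  induction e generalizing t with
  | const a => exact mem_idle_test_idle
  | var x => exact mem_idle_test_idle
  | unary f e ih =>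
    have htest : ∀ a, t ∈ ((e.eval a).seq (test {_σ | f a = k})).traces ↔ _ := fun a =>
      mem_seq_test fun u hu => (ih.1 hu).1.1
    simp only [eval, mem_iSup, htest, ih]
    constructor
    · rintro (⟨s, rfl⟩ | ⟨a, ⟨h₁, h₂⟩, h₃⟩)
      · exact ⟨idle_nil s, by simp⟩
      · exact ⟨h₁, fun s l h => ⟨a, h₂ s l h, h₃ s l h⟩⟩
    · rintro ⟨h, h'⟩
      right
      by_cases ht : ∃ s l, t = fin s l Status.terminated
      · obtain ⟨s, l, rfl⟩ := ht
        obtain ⟨a, h₁, h₂⟩ := h' s l rfl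
        exact ⟨a, ⟨h, fun s' l' hl => by cases hl; exact h₁⟩, fun _ _ _ => h₂⟩
      -- An unfinished evaluation puts no condition on the operand value; this one is a default.
      · exact ⟨e.value t.start, ⟨h, fun s l hl => absurd ⟨s, l, hl⟩ ht⟩,
          fun s l hl => absurd ⟨s, l, hl⟩ ht⟩
  | binary f e₁ e₂ ih₁ ih₂ =>
    have hpar : ∀ a b (t : Trace (State Val)), t ∈ ((e₁.eval a).par (e₂.eval b)).traces ↔
        t.Idle ∧ ∀ s l, t = fin s l Status.terminated →
          e₁.Evaluates (visited s l) a ∧ e₂.Evaluates (visited s l) b := by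
      intro a b t
      constructor
      · rintro (⟨t₁, h₁, t₂, h₂, h⟩ | ⟨s, l, l₁, l₂, -, -, ⟨h, -⟩ | ⟨-, h⟩⟩)
        · rw [ih₁] at h₁
          rw [ih₂] at h₂
          refine ⟨ParTrace.idle h h₁.1 h₂.1, ?_⟩
          rintro s l rfl
          cases t₁ <;> cases t₂ <;> try exact h.elim
          obtain ⟨rfl, rfl, rfl, rfl, h⟩ := h
          have heq := ParSteps.eq h
          rw [← visited_congr heq.1]
          refine ⟨h₁.2 _ _ rfl, ?_⟩
          rw [visited_congr (heq.1.trans heq.2.symm)]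
          exact h₂.2 _ _ rfl
        · exact absurd rfl (ih₁.1 h).1.1
        · exact absurd rfl (ih₂.1 h).1.1
      · rintro ⟨h, h'⟩
        -- The first operand makes all the program transitions while the second only observes them.
        refine Or.inl ⟨t, ih₁.2 ⟨h, fun s l hl => (h' s l hl).1⟩, t.toEnv,
          ih₂.2 ⟨h.toEnv, fun s l hl => ?_⟩, parTrace_toEnv t⟩
        cases t with
        | inf _ _ => cases hl
        | fin s₁ m st =>
          cases hl
          rw [visited_congr (m := m) (by simp)]
          exact (h' _ _ rfl).2
    have htest : ∀ a b, t ∈ (((e₁.eval a).par (e₂.eval b)).seq (test {_σ | f a b = k})).traces ↔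
        _ := fun a b => mem_seq_test fun u hu => ((hpar a b u).1 hu).1.1
    simp only [eval, mem_iSup, htest, hpar]
    constructor
    · rintro (⟨s, rfl⟩ | ⟨a, ⟨s, rfl⟩ | ⟨b, ⟨h₁, h₂⟩, h₃⟩⟩)
      · exact ⟨idle_nil s, by simp⟩
      · exact ⟨idle_nil s, by simp⟩
      · exact ⟨h₁, fun s l h => ⟨a, b, (h₂ s l h).1, (h₂ s l h).2, h₃ s l h⟩⟩
    · rintro ⟨h, h'⟩
      right
      by_cases ht : ∃ s l, t = fin s l Status.terminated
      · obtain ⟨s, l, rfl⟩ := ht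
        obtain ⟨a, b, h₁, h₂, h₃⟩ := h' s l rfl
        exact ⟨a, Or.inr ⟨b, ⟨h, fun s' l' hl => by cases hl; exact ⟨h₁, h₂⟩⟩,
          fun _ _ _ => h₃⟩⟩
      · exact ⟨e₁.value t.start, Or.inr ⟨e₂.value t.start,
          ⟨h, fun s l hl => absurd ⟨s, l, hl⟩ ht⟩, fun s l hl => absurd ⟨s, l, hl⟩ ht⟩⟩

/-- Along a stuttering trace whose environment respects `r`, an expression that is invariant under
`r` has the same value in all states. -/
theorem InvariantUnder.value_eq {r : Set (State Val × State Val)} {α : Type} {e : Expr Val α}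
    (he : e.InvariantUnder r) {s : State Val} {l : List (Step (State Val))} {st : Status}
    (h₁ : (fin s l st).Steps Stutter) (h₂ : (fin s l st).Steps (EnvIn r)) :
    ∀ σ ∈ visited s l, e.value σ = e.value s := by
  rintro _ ⟨m, hm, rfl⟩
  induction m using List.reverseRecOn with
  | nil => rfl
  | append_singleton m a ih =>
    rw [← ih ((List.prefix_append _ _).trans hm), finalState_append]
    change e.value a.2 = _
    have h₁ := h₁ s m a ⟨rfl, hm⟩
    have h₂ := h₂ s m a ⟨rfl, hm⟩
    rcases hk : a.1 with _ | _
    · rw [h₁ hk]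
    · exact he _ _ (h₂ hk)

end Expr

/-! ### Refinement of evaluations and the main theorem -/

namespace Cmd

open Trace

theorem regularRefines_eval {I : Set (State Val)} {r₁ r₂ : Set (State Val × State Val)}
    (hr : preRel I ∩ r₁ ∩ postRel I ⊆ r₂) {α β : Type} {e₁ : Expr Val α} {e₂ : Expr Val β}
    {k₁ : α} {k₂ : β} (he : e₂.SingleReference r₂)
    (hk : I ∩ {σ | e₂.value σ = k₂} ⊆ {σ | e₁.value σ = k₁}) :
    RegularRefines I r₁ (e₁.eval k₁) (e₂.eval k₂) := by
  intro t ht hm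
  rw [Expr.mem_eval] at hm ⊢
  refine ⟨hm.1, ?_⟩
  rintro s l rfl
  -- A regular trace with a violation would be incomplete, but this one has terminated.
  have henv : (fin s l Status.terminated).Steps (EnvIn r₂) := by
    refine ht.1.envIn hr (by_contra fun hn => ?_)
    have := ht.2 s l (hasPrefix_fin_self _ _ _) fun h =>
      hn (h.of_hasPrefix (hasPrefix_fin_self _ _ _) _)
    cases this
  obtain ⟨σ, hσ, hv⟩ := (hm.2 s l rfl).exists_value (r := r₂)
    (fun γ e h σ hσ σ' hσ' => (h.value_eq hm.1.2.1 henv σ hσ).trans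
      (h.value_eq hm.1.2.1 henv σ' hσ').symm) he
  have hI : σ ∈ I := by
    obtain ⟨m, hp, rfl⟩ := hσ
    rcases List.eq_nil_or_concat m with rfl | ⟨m, a, rfl⟩
    · exact ht.1.1
    · rw [List.concat_eq_append] at hp ⊢
      rw [finalState_append]
      exact ht.1.2 s m a ⟨rfl, hp⟩
  obtain rfl : e₁.value σ = k₁ := hk ⟨hI, hv⟩
  exact Expr.evaluates_value hσ e₁

end Cmd
end RelyGuarantee
open RelyGuarantee RelyGuarantee.Cmd in
theorem mainTheorem6 {Var : Type*} {Val : Var → Type} (I : Set (State Val))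
    (r₁ r₂ : Set (State Val × State Val)) (hr : preRel I ∩ r₁ ∩ postRel I ⊆ r₂) :
    -- evaluation of expressions
    (∀ (α β : Type) (e₁ : Expr Val α) (e₂ : Expr Val β) (k₁ : α) (k₂ : β),
      e₁.SingleReference r₁ → e₂.SingleReference r₂ →
      I ∩ {σ | e₂.value σ = k₂} ⊆ {σ | e₁.value σ = k₁} →
      DataReifies I ((rely r₁).conj (e₁.eval k₁)) ((rely r₂).conj (e₂.eval k₂))) ∧
    -- conditionals
    (∀ (b₁ b₂ : Expr Val Bool) (c₁ c₂ d₁ d₂ : Cmd (State Val)),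
      b₁.SingleReference r₁ → b₂.SingleReference r₂ →
      I ∩ {σ | b₁.value σ = true} = I ∩ {σ | b₂.value σ = true} →
      DataReifies I c₁ d₁ → DataReifies I c₂ d₂ →
      DataReifies I ((rely r₁).conj (ifThenElse b₁ c₁ c₂))
        ((rely r₂).conj (ifThenElse b₂ d₁ d₂))) ∧
    -- loops
    (∀ (b₁ b₂ : Expr Val Bool) (c₁ c₂ : Cmd (State Val)),
      b₁.SingleReference r₁ → b₂.SingleReference r₂ →
      I ∩ {σ | b₁.value σ = true} = I ∩ {σ | b₂.value σ = true} →
      DataReifies I c₁ c₂ →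
      DataReifies I ((rely r₁).conj (whileDo b₁ c₁)) ((rely r₂).conj (whileDo b₂ c₂))) := by
  have hbool : ∀ b₁ b₂ : Expr Val Bool, b₂.SingleReference r₂ →
      I ∩ {σ | b₁.value σ = true} = I ∩ {σ | b₂.value σ = true} →
      ∀ k, RegularRefines I r₁ (b₁.eval k) (b₂.eval k) := by
    intro b₁ b₂ h₂ hb k
    refine regularRefines_eval hr h₂ ?_
    rintro σ ⟨hI, hk⟩
    have := Set.ext_iff.1 hb σ
    -- On `I` the guards are true in the same states, hence equal as booleans; this covers the value
    -- `false` as well.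
    simp only [Set.mem_inter_iff, Set.mem_ofPred_eq, hI, true_and] at this hk ⊢
    rw [← hk]
    exact Bool.eq_iff_iff.2 this
  refine ⟨fun α β e₁ e₂ k₁ k₂ _ h₂ hk => (regularRefines_eval hr h₂ hk).dataReifies hr,
    fun b₁ b₂ c₁ c₂ d₁ d₂ _ h₂ hb hc hd => ?_, fun b₁ b₂ c₁ c₂ _ h₂ hb hc => ?_⟩
  · exact RegularRefines.dataReifies hr <|
      (((hbool b₁ b₂ h₂ hb true).seq (hc.regularRefines r₁)).sup
        ((hbool b₁ b₂ h₂ hb false).seq (hd.regularRefines r₁))).seq (.refl I r₁ _)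
  · exact RegularRefines.dataReifies hr <|
      ((hbool b₁ b₂ h₂ hb true).seq (hc.regularRefines r₁)).iter.seq (hbool b₁ b₂ h₂ hb false)
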